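/- **Proposition 2.1.** Let $B=(B(x))_{x\in\mathbb{R}}$ be a standard one-dimensional Brownian motion indexed by $\mathbb{R}$ (with $B(0)=0$ almost surely) on a probability space $(\Omega,\mathcal F,\mathbb{P})$. For $t>0$ and $x\in\mathbb{R}$ let $$P_t(x)=\frac{e^{-x^2/(4t)}}{\sqrt{4\pi t}},\qquad V(0,x)=B(x),\qquad V(t,x)=\int_{\mathbb{R}}P_t(x-y)\,B(y)\,dy,\qquad u(t,x)=-\partial_xV(t,x),$$ so that, almost surely, $\partial_tV=\partial_{xx}V$ on $(0,\infty)\times\mathbb{R}$. Then there exists a process $X=(X_t)_{t\ge 0}$ on $(\Omega,\mathcal F,\mathbb{P})$ (that is, each $X_t$ is a real random variable) such that, almost surely, $$X_0=0\qquad\text{and}\qquad \partial_tX_t=u(t,X_t)\quad\text{for all }t>0,$$ and $t\mapsto X_t$ is continuous on $\mathbb{R}_+=[0,\infty)$ and smooth ($C^\infty$) on $(0,\infty)$. -/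

import Mathlib

open MeasureTheory ProbabilityTheory Set
open scoped NNReal

/-- A standard one-dimensional Brownian motion `B = (B x)` indexed by the whole line: the two
half-line processes `x ↦ B x` and `x ↦ B (-x)`, `x ≥ 0`, are independent standard Brownian
motions (centred Gaussian with covariance `min`, hence started from `0`, with almost surely
continuous paths). -/
structure IsTwoSidedBrownian {Ω : Type*} [MeasurableSpace Ω]
    (B : ℝ → Ω → ℝ) (P : Measure Ω) : Prop where
  measurable : ∀ x, Measurable (B x)
  right : IsBrownianReal (fun (x : ℝ≥0) ω => B (x : ℝ) ω) P
  left : IsBrownianReal (fun (x : ℝ≥0) ω => B (-(x : ℝ)) ω) P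
  indep : IndepFun (fun ω (x : ℝ≥0) => B (x : ℝ) ω) (fun ω (x : ℝ≥0) => B (-(x : ℝ)) ω) P

/-- The heat kernel `P_t(x) = exp (-x² / (4t)) / √(4πt)`, used for `t > 0`. -/
noncomputable def heatKernel (t x : ℝ) : ℝ :=
  Real.exp (-x ^ 2 / (4 * t)) / Real.sqrt (4 * Real.pi * t)

/-- The potential `V(t,x)` with initial condition the path `b`, evolved by the heat equation
`∂ₜV = ∂ₓₓV`: `V(0,x) = b x`, and `V(t,x) = ∫ P_t(x - y) b(y) dy` for `t > 0`. -/
noncomputable def potential (b : ℝ → ℝ) (t x : ℝ) : ℝ :=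
  if 0 < t then ∫ y, heatKernel t (x - y) * b y else b x

/-- The velocity field `u = -∂ₓV`. -/
noncomputable def velocity (b : ℝ → ℝ) (t x : ℝ) : ℝ :=
  -deriv (fun z => potential b t z) x

/-! The field `u` is smooth at positive times, so the only difficulty is to start the equation at
time `0`, where `u` blows up. Almost surely `|u(t,x)| ≤ C (1 + |x| + √t) t^(-3/8)`, and this rate is
integrable at `0`. Grönwall then bounds every curve started from `0` at a time `s > 0` by `√(exp (4
G t) - 1)`, uniformly in `s`, where `G` is the primitive of the rate and `G t → 0` as `t → 0`.

The flow of a scalar equation is continuous and nondecreasing in the starting point, so it commutes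
with limsups. The limsup `X` of the curves started from `0` at times `1/(n+1)` is therefore carried
to itself by the flow (`flow_upperTrajectory`): it is an integral curve on `(0, ∞)`, and the uniform
bound makes it continuous at `0`. Uniqueness from time `0` is not needed. A limsup, unlike a limit
point chosen by compactness, is measurable in `ω` as soon as the flow is (`measurable_flow`).

The bound on `u` (`exists_abs_velocity_le`) uses only that `(b y - b z)^8 / ((y - z)^4 (1 + y²)(1 +
z²))` is integrable on the plane. For Brownian paths this follows from Tonelli and `E (B y - B z)^8
≤ C (y - z)^4`. -/

open Filter Topology

/-! ### Scalar equations with linear growth, integrable in time at `0`. -/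

/-- A time-dependent vector field on `(0, ∞) × ℝ`, of class `C¹`, whose growth is at most linear with
a rate `g` that is integrable at time `0` (its primitive `G` is continuous up to `0`). -/
structure IsLinearGrowthField (v : ℝ → ℝ → ℝ) (G g : ℝ → ℝ) : Prop where
  contDiffOn : ContDiffOn ℝ 1 (Function.uncurry v) (Ioi 0 ×ˢ univ)
  hasDerivAt : ∀ t, 0 < t → HasDerivAt G (g t) t
  continuousOn : ContinuousOn G (Ici 0)
  map_zero : G 0 = 0
  growth : ∀ t, 0 < t → ∀ x, |v t x| ≤ g t * (1 + |x|)

/-- Truncation of a vector field: the space variable is clamped to `[-N, N]`. -/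
noncomputable def clampField (v : ℝ → ℝ → ℝ) (N : ℝ) (t x : ℝ) : ℝ := v t (max (-N) (min N x))

/-- The value at time `t` of the integral curve of `v` started from `x` at time `s`. -/
noncomputable def flow (v : ℝ → ℝ → ℝ) (s t x : ℝ) : ℝ :=
  open Classical in
  if h : ∃ γ : ℝ → ℝ, γ s = x ∧ IsIntegralCurveOn γ v (Icc s t) then h.choose t else 0

/-- The upper limit, as the starting time decreases to `0`, of the integral curves of `v` started
from `0`. -/
noncomputable def upperTrajectory (v : ℝ → ℝ → ℝ) (t : ℝ) : ℝ :=
  -- The default `0` keeps the sequence bounded for every `t`; for `t > 0` it concerns finitely many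
  -- `n`.
  limsup (fun n : ℕ => if 1 / ((n : ℝ) + 1) ≤ t then flow v (1 / ((n : ℝ) + 1)) t 0 else 0) atTop

lemma abs_clamp_le {N : ℝ} (hN : 0 ≤ N) (x : ℝ) : |max (-N) (min N x)| ≤ N := by
  rw [abs_le]
  exact ⟨le_max_left _ _, max_le (by linarith) (min_le_left _ _)⟩

lemma abs_clamp_le_abs {N : ℝ} (hN : 0 ≤ N) (x : ℝ) : |max (-N) (min N x)| ≤ |x| := by
  rw [abs_le]
  refine ⟨?_, max_le (by linarith [abs_nonneg x]) ((min_le_right _ _).trans (le_abs_self x))⟩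
  rcases le_total N x with h | h
  · rw [min_eq_left h]
    exact le_max_of_le_right (by linarith [abs_nonneg x])
  · rw [min_eq_right h]
    exact le_max_of_le_right (neg_abs_le x)

lemma clamp_eq_self {N x : ℝ} (hx : |x| ≤ N) : max (-N) (min N x) = x := by
  rw [abs_le] at hx
  rw [min_eq_right hx.2, max_eq_right hx.1]

lemma lipschitzWith_clamp (N : ℝ) : LipschitzWith 1 (fun x : ℝ => max (-N) (min N x)) :=
  (LipschitzWith.id.const_min N).const_max (-N)

lemma IsIntegralCurveOn.hasDerivWithinAt_Ici {γ : ℝ → ℝ} {v : ℝ → ℝ → ℝ} {s S t : ℝ}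
    (h : IsIntegralCurveOn γ v (Icc s S)) (ht : t ∈ Ico s S) :
    HasDerivWithinAt γ (v t (γ t)) (Ici t) t :=
  (h t (Ico_subset_Icc_self ht)).mono_of_mem_nhdsWithin (Icc_mem_nhdsGE_of_mem ht)

/-- Grönwall for the smooth quantity `1 + γ²`: its derivative is at most `2 g |γ| (1 + |γ|) ≤ 4 g (1
+ γ²)`, so `(1 + γ²) exp (-4G)` is nonincreasing. -/
lemma one_add_sq_le_of_isIntegralCurveOn {w : ℝ → ℝ → ℝ} {G g γ : ℝ → ℝ} {s S : ℝ}
    (hG : ∀ t ∈ Icc s S, HasDerivAt G (g t) t)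
    (hw : ∀ t ∈ Icc s S, ∀ x, |w t x| ≤ g t * (1 + |x|))
    (hγ : IsIntegralCurveOn γ w (Icc s S)) {t : ℝ} (ht : t ∈ Icc s S) :
    1 + γ t ^ 2 ≤ (1 + γ s ^ 2) * Real.exp (4 * (G t - G s)) := by
  have hanti : AntitoneOn (fun t => (1 + γ t ^ 2) * Real.exp (-(4 * G t))) (Icc s S) := by
    have hd : ∀ t ∈ Icc s S, HasDerivWithinAt (fun t => (1 + γ t ^ 2) * Real.exp (-(4 * G t)))
        ((2 * γ t * w t (γ t) - 4 * g t * (1 + γ t ^ 2)) * Real.exp (-(4 * G t))) (Icc s S) t := by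
      intro t ht
      have h1 := ((hγ t ht).pow 2).const_add 1
      have h2 := (((hG t ht).const_mul 4).neg.exp).hasDerivWithinAt (s := Icc s S)
      refine (h1.mul h2).congr_deriv ?_
      simp
      ring
    refine antitoneOn_of_deriv_nonpos (convex_Icc s S)
      (fun t ht => (hd t ht).continuousWithinAt)
      (fun t ht => ((hd t (interior_subset ht)).mono interior_subset).differentiableWithinAt) ?_
    intro t ht
    rw [((hd t (interior_subset ht)).hasDerivAt (mem_interior_iff_mem_nhds.1 ht)).deriv]
    refine mul_nonpos_of_nonpos_of_nonneg ?_ (Real.exp_nonneg _)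
    have h1 := hw t (interior_subset ht) (γ t)
    have hg : 0 ≤ g t := by
      have h0 := hw t (interior_subset ht) 0
      simp at h0
      exact (abs_nonneg _).trans h0
    have h2 : γ t * w t (γ t) ≤ |γ t| * (g t * (1 + |γ t|)) :=
      (le_abs_self _).trans (by rw [abs_mul]; gcongr)
    have h3 : |γ t| * (1 + |γ t|) ≤ 2 * (1 + γ t ^ 2) := by
      rw [← sq_abs (γ t)]; nlinarith [sq_nonneg (|γ t| - 1)]
    nlinarith [mul_le_mul_of_nonneg_left h3 hg]
  have h := hanti (left_mem_Icc.2 (ht.1.trans ht.2)) ht ht.1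
  simp only at h
  have e : (1 + γ t ^ 2) = (1 + γ t ^ 2) * Real.exp (-(4 * G t)) * Real.exp (4 * G t) := by
    rw [mul_assoc, ← Real.exp_add]; simp
  rw [e]
  calc _ ≤ (1 + γ s ^ 2) * Real.exp (-(4 * G s)) * Real.exp (4 * G t) := by gcongr
    _ = _ := by rw [mul_assoc, ← Real.exp_add]; ring_nf

namespace IsLinearGrowthField

variable {v : ℝ → ℝ → ℝ} {G g : ℝ → ℝ}

lemma rate_nonneg (h : IsLinearGrowthField v G g) {t : ℝ} (ht : 0 < t) : 0 ≤ g t := by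
  have h0 := h.growth t ht 0
  simp at h0
  exact (abs_nonneg _).trans h0

lemma monotoneOn (h : IsLinearGrowthField v G g) : MonotoneOn G (Ici 0) := by
  refine monotoneOn_of_deriv_nonneg (convex_Ici 0) h.continuousOn ?_ ?_
  · intro t ht
    rw [interior_Ici] at ht
    exact (h.hasDerivAt t ht).differentiableAt.differentiableWithinAt
  · intro t ht
    rw [interior_Ici] at ht
    rw [(h.hasDerivAt t ht).deriv]
    exact h.rate_nonneg ht

lemma exists_lipschitzOnWith (h : IsLinearGrowthField v G g) {s : ℝ} (hs : 0 < s) (S N : ℝ) :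
    ∃ K : ℝ≥0, ∀ t ∈ Icc s S, LipschitzOnWith K (v t) (Icc (-N) N) := by
  obtain ⟨K, hK⟩ := (h.contDiffOn.mono (t := Icc s S ×ˢ Icc (-N) N)
    (prod_mono (fun t ht => hs.trans_le ht.1) (subset_univ _))).exists_lipschitzOnWith
    one_ne_zero ((convex_Icc _ _).prod (convex_Icc _ _)) (isCompact_Icc.prod isCompact_Icc)
  refine ⟨K, fun t ht x hx y hy => ?_⟩
  have := hK (x := (t, x)) ⟨ht, hx⟩ (y := (t, y)) ⟨ht, hy⟩
  simpa [Prod.edist_eq] using this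

lemma abs_clampField_le (h : IsLinearGrowthField v G g) {N : ℝ} (hN : 0 ≤ N) {t : ℝ} (ht : 0 < t)
    (x : ℝ) : |clampField v N t x| ≤ g t * (1 + |x|) := by
  refine (h.growth t ht _).trans ?_
  have := h.rate_nonneg ht
  gcongr g t * (1 + ?_)
  exact abs_clamp_le_abs hN x

lemma continuousOn_clampField (h : IsLinearGrowthField v G g) (N : ℝ) :
    ContinuousOn (Function.uncurry (clampField v N)) (Ioi 0 ×ˢ univ) := by
  have : ContinuousOn (fun p : ℝ × ℝ => (p.1, max (-N) (min N p.2))) (Ioi 0 ×ˢ univ) :=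
    Continuous.continuousOn (by fun_prop)
  exact h.contDiffOn.continuousOn.comp this (fun p hp => ⟨hp.1, mem_univ _⟩)

lemma exists_lipschitzWith_clampField (h : IsLinearGrowthField v G g) {s : ℝ} (hs : 0 < s) (S : ℝ)
    {N : ℝ} (hN : 0 ≤ N) :
    ∃ K : ℝ≥0, ∀ t ∈ Icc s S, LipschitzWith K (clampField v N t) := by
  obtain ⟨K, hK⟩ := h.exists_lipschitzOnWith hs S N
  refine ⟨K, fun t ht => ?_⟩
  have := (hK t ht).comp (lipschitzWith_clamp N).lipschitzOnWith (s := univ)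
    (fun x _ => abs_le.1 (abs_clamp_le hN x))
  rw [lipschitzOnWith_univ, mul_one] at this
  exact this

/-- The clamped field is bounded and globally Lipschitz in space on `[s, S]`, so Picard–Lindelöf
applies on the whole interval at once. -/
lemma exists_isIntegralCurveOn_clampField (h : IsLinearGrowthField v G g) {s S : ℝ} (hs : 0 < s)
    (hS : s ≤ S) {N : ℝ} (hN : 0 ≤ N) (x : ℝ) :
    ∃ γ : ℝ → ℝ, γ s = x ∧ IsIntegralCurveOn γ (clampField v N) (Icc s S) := by
  obtain ⟨K, hK⟩ := h.exists_lipschitzWith_clampField hs S hN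
  obtain ⟨L, hL⟩ := (isCompact_Icc.prod isCompact_Icc).exists_bound_of_continuousOn
    (h.contDiffOn.continuousOn.mono (t := Icc s S ×ˢ Icc (-N) N)
    (prod_mono (fun t ht => hs.trans_le ht.1) (subset_univ _)))
  have hL' : ∀ t ∈ Icc s S, ∀ y, ‖clampField v N t y‖ ≤ L := fun t ht y =>
    hL (t, _) ⟨ht, abs_le.1 (abs_clamp_le hN y)⟩
  have hL0 : 0 ≤ L := (norm_nonneg _).trans (hL' s (left_mem_Icc.2 hS) 0)
  have hPL : IsPicardLindelof (clampField v N) (⟨s, left_mem_Icc.2 hS⟩ : Icc s S) x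
      -- A curve of speed at most `L` stays within `L (S - s)` of its starting point.
      (⟨L, hL0⟩ * ⟨S - s, sub_nonneg.2 hS⟩) 0 ⟨L, hL0⟩ K :=
    { lipschitzOnWith := fun t ht => (hK t ht).lipschitzOnWith
      continuousOn := fun y _ => (h.continuousOn_clampField N).comp (t := Ioi 0 ×ˢ univ)
        (f := fun t => (t, y)) (Continuous.continuousOn (by fun_prop))
        (fun t ht => ⟨hs.trans_le ht.1, mem_univ _⟩)
      norm_le := fun t ht y _ => hL' t ht y
      mul_max_le := by
        rw [max_eq_left (by simp [hS])]
        simp only [NNReal.coe_zero, sub_zero]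
        exact le_rfl }
  exact hPL.exists_eq_forall_mem_Icc_hasDerivWithinAt₀

/-- A bound at times in `[s, S]` for integral curves started at time `s`. -/
lemma abs_le_of_isIntegralCurveOn (h : IsLinearGrowthField v G g) {w : ℝ → ℝ → ℝ} {s S : ℝ}
    (hs : 0 < s) (hw : ∀ t, 0 < t → ∀ x, |w t x| ≤ g t * (1 + |x|)) {γ : ℝ → ℝ}
    (hγ : IsIntegralCurveOn γ w (Icc s S)) {M : ℝ} (hM : |γ s| ≤ M) {t : ℝ} (ht : t ∈ Icc s S) :
    |γ t| ≤ Real.sqrt ((1 + M ^ 2) * Real.exp (4 * (G S - G s))) := by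
  have h1 := one_add_sq_le_of_isIntegralCurveOn (fun t ht => h.hasDerivAt t (hs.trans_le ht.1))
    (fun t ht => hw t (hs.trans_le ht.1)) hγ ht
  have hGm : G t ≤ G S := h.monotoneOn (hs.le.trans ht.1) (hs.le.trans (ht.1.trans ht.2)) ht.2
  have h2 : γ s ^ 2 ≤ M ^ 2 := sq_le_sq.2 (hM.trans (le_abs_self M))
  refine Real.abs_le_sqrt ?_
  calc γ t ^ 2 ≤ 1 + γ t ^ 2 := by linarith
    _ ≤ _ := h1
    _ ≤ _ := by gcongr

/-- Clamping preserves the growth bound, so the a priori estimate confines the clamped curve to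
`[-N, N]`, where both fields agree. -/
lemma isIntegralCurveOn_of_clampField (h : IsLinearGrowthField v G g) {s S N : ℝ} (hs : 0 < s)
    (hN : 0 ≤ N) {γ : ℝ → ℝ} (hγ : IsIntegralCurveOn γ (clampField v N) (Icc s S))
    (hNS : Real.sqrt ((1 + |γ s| ^ 2) * Real.exp (4 * (G S - G s))) ≤ N) :
    IsIntegralCurveOn γ v (Icc s S) := by
  intro t ht
  have h1 := h.abs_le_of_isIntegralCurveOn hs
    (fun t ht => h.abs_clampField_le hN ht) hγ le_rfl ht
  have h2 := hγ t ht
  rwa [clampField, clamp_eq_self (h1.trans hNS)] at h2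

lemma exists_isIntegralCurveOn (h : IsLinearGrowthField v G g) {s S : ℝ} (hs : 0 < s)
    (hS : s ≤ S) (x : ℝ) :
    ∃ γ : ℝ → ℝ, γ s = x ∧ IsIntegralCurveOn γ v (Icc s S) := by
  obtain ⟨γ, hx, hγ⟩ := h.exists_isIntegralCurveOn_clampField hs hS
    (N := Real.sqrt ((1 + |x| ^ 2) * Real.exp (4 * (G S - G s)))) (Real.sqrt_nonneg _) x
  exact ⟨γ, hx, h.isIntegralCurveOn_of_clampField hs (Real.sqrt_nonneg _) hγ (by rw [hx])⟩

/-- Curves starting in `[-M, M]` stay in one compact interval, on which the field is uniformly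
Lipschitz. Uniqueness and continuity of the flow both follow. -/
lemma exists_dist_le (h : IsLinearGrowthField v G g) {s : ℝ} (hs : 0 < s) (S M : ℝ) :
    ∃ K : ℝ≥0, ∀ γ η : ℝ → ℝ, IsIntegralCurveOn γ v (Icc s S) → IsIntegralCurveOn η v (Icc s S) →
      |γ s| ≤ M → |η s| ≤ M →
      ∀ t ∈ Icc s S, dist (γ t) (η t) ≤ dist (γ s) (η s) * Real.exp (K * (t - s)) := by
  obtain ⟨K, hK⟩ := h.exists_lipschitzOnWith hs S
    (Real.sqrt ((1 + M ^ 2) * Real.exp (4 * (G S - G s))))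
  refine ⟨K, fun γ η hγ hη hγM hηM => ?_⟩
  refine dist_le_of_trajectories_ODE_of_mem (fun t ht => hK t (Ico_subset_Icc_self ht))
    hγ.continuousOn (fun t ht => hγ.hasDerivWithinAt_Ici ht) (fun t ht => ?_)
    hη.continuousOn (fun t ht => hη.hasDerivWithinAt_Ici ht) (fun t ht => ?_) le_rfl
  · exact abs_le.1 (h.abs_le_of_isIntegralCurveOn hs h.growth hγ hγM (Ico_subset_Icc_self ht))
  · exact abs_le.1 (h.abs_le_of_isIntegralCurveOn hs h.growth hη hηM (Ico_subset_Icc_self ht))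

lemma eqOn_of_isIntegralCurveOn (h : IsLinearGrowthField v G g) {s S : ℝ} (hs : 0 < s)
    {γ η : ℝ → ℝ} (hγ : IsIntegralCurveOn γ v (Icc s S)) (hη : IsIntegralCurveOn η v (Icc s S))
    (he : γ s = η s) : EqOn γ η (Icc s S) := by
  obtain ⟨K, hK⟩ := h.exists_dist_le hs S |γ s|
  intro t ht
  have := hK γ η hγ hη le_rfl (by rw [he]) t ht
  rw [he, dist_self, zero_mul] at this
  exact dist_le_zero.1 this

lemma flow_eq (h : IsLinearGrowthField v G g) {s S : ℝ} (hs : 0 < s)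
    {γ : ℝ → ℝ} (hγ : IsIntegralCurveOn γ v (Icc s S)) {t : ℝ} (ht : t ∈ Icc s S) :
    flow v s t (γ s) = γ t := by
  have hγ' := hγ.mono (Icc_subset_Icc_right ht.2)
  have hex : ∃ η : ℝ → ℝ, η s = γ s ∧ IsIntegralCurveOn η v (Icc s t) := ⟨γ, rfl, hγ'⟩
  rw [flow, dif_pos hex]
  exact h.eqOn_of_isIntegralCurveOn hs hex.choose_spec.2 hγ' hex.choose_spec.1
    (right_mem_Icc.2 ht.1)

lemma flow_self (h : IsLinearGrowthField v G g) {s : ℝ} (hs : 0 < s) (x : ℝ) :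
    flow v s s x = x := by
  obtain ⟨γ, rfl, hγ⟩ := h.exists_isIntegralCurveOn hs le_rfl x
  exact h.flow_eq hs hγ (left_mem_Icc.2 le_rfl)

lemma isIntegralCurveOn_flow (h : IsLinearGrowthField v G g) {s : ℝ} (hs : 0 < s) (S x : ℝ) :
    IsIntegralCurveOn (fun t => flow v s t x) v (Icc s S) := by
  rcases lt_or_ge S s with hS | hS
  · simp [IsIntegralCurveOn, Icc_eq_empty (not_le.2 hS)]
  obtain ⟨γ, rfl, hγ⟩ := h.exists_isIntegralCurveOn hs hS x
  intro t ht
  have e : ∀ r ∈ Icc s S, flow v s r (γ s) = γ r := fun r hr => h.flow_eq hs hγ hr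
  simp only [e t ht]
  exact (hγ t ht).congr e (e t ht)

lemma flow_flow (h : IsLinearGrowthField v G g) {r s t : ℝ} (hr : 0 < r) (hrs : r ≤ s)
    (hst : s ≤ t) (x : ℝ) : flow v s t (flow v r s x) = flow v r t x :=
  h.flow_eq (hr.trans_le hrs) (γ := fun t => flow v r t x)
    ((h.isIntegralCurveOn_flow hr t x).mono (Icc_subset_Icc_left hrs)) (right_mem_Icc.2 hst)

/-- If two curves exchanged their order they would meet, and by uniqueness coincide afterwards. -/
lemma monotone_flow (h : IsLinearGrowthField v G g) {s t : ℝ} (hs : 0 < s) (hst : s ≤ t) :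
    Monotone (flow v s t) := by
  intro x y hxy
  by_contra! hlt
  have hx := h.isIntegralCurveOn_flow hs t x
  have hy := h.isIntegralCurveOn_flow hs t y
  have hc : ContinuousOn (fun r => flow v s r y - flow v s r x) (Icc s t) :=
    hy.continuousOn.sub hx.continuousOn
  obtain ⟨r, hr, hr0⟩ := intermediate_value_Icc' hst hc (show (0 : ℝ) ∈ Icc _ _ by
    simp only [h.flow_self hs, mem_Icc]
    constructor <;> linarith)
  have hr1 : flow v s r y = flow v s r x := sub_eq_zero.1 hr0
  rw [← h.flow_flow hs hr.1 hr.2 x, ← h.flow_flow hs hr.1 hr.2 y, hr1] at hlt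
  exact lt_irrefl _ hlt

lemma continuous_flow (h : IsLinearGrowthField v G g) {s t : ℝ} (hs : 0 < s) (hst : s ≤ t) :
    Continuous (flow v s t) := by
  rw [continuous_iff_continuousAt]
  intro x
  obtain ⟨K, hK⟩ := h.exists_dist_le hs t (|x| + 1)
  rw [ContinuousAt, tendsto_iff_dist_tendsto_zero]
  have hlim : Tendsto (fun y => dist y x * Real.exp (K * (t - s))) (𝓝 x) (𝓝 0) := by
    have : Continuous (fun y => dist y x * Real.exp (K * (t - s))) := by fun_prop
    simpa using this.tendsto x
  refine squeeze_zero' (Eventually.of_forall fun _ => dist_nonneg) ?_ hlim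
  filter_upwards [Metric.ball_mem_nhds x one_pos] with y hy
  have h1 : |y| ≤ |x| + 1 := by
    have h2 : |y - x| < 1 := by simpa [Real.dist_eq] using hy
    linarith [abs_sub_abs_le_abs_sub y x]
  have := hK _ _ (h.isIntegralCurveOn_flow hs t y) (h.isIntegralCurveOn_flow hs t x)
    (by simpa [h.flow_self hs] using h1) (by simp [h.flow_self hs]) t (right_mem_Icc.2 hst)
  simpa [h.flow_self hs] using this

lemma flow_zero_sq_le (h : IsLinearGrowthField v G g) {s t : ℝ} (hs : 0 < s) (hst : s ≤ t) :
    flow v s t 0 ^ 2 ≤ Real.exp (4 * G t) - 1 := by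
  have h1 := one_add_sq_le_of_isIntegralCurveOn (fun t ht => h.hasDerivAt t (hs.trans_le ht.1))
    (fun t ht => h.growth t (hs.trans_le ht.1)) (h.isIntegralCurveOn_flow hs t 0)
    (right_mem_Icc.2 hst)
  simp only [h.flow_self hs] at h1
  have h2 : 0 ≤ G s := by
    rw [← h.map_zero]; exact h.monotoneOn self_mem_Ici hs.le hs.le
  have h3 : Real.exp (4 * (G t - G s)) ≤ Real.exp (4 * G t) := Real.exp_le_exp.2 (by linarith)
  linarith

lemma abs_approx_le (h : IsLinearGrowthField v G g) (t : ℝ) (n : ℕ) :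
    |if 1 / ((n : ℝ) + 1) ≤ t then flow v (1 / ((n : ℝ) + 1)) t 0 else 0| ≤
      Real.sqrt (Real.exp (4 * G t) - 1) := by
  split_ifs with hn
  · exact Real.abs_le_sqrt (h.flow_zero_sq_le (by positivity) hn)
  · simp

lemma abs_upperTrajectory_le (h : IsLinearGrowthField v G g) (t : ℝ) :
    |upperTrajectory v t| ≤ Real.sqrt (Real.exp (4 * G t) - 1) := by
  have hb := fun n => abs_le.1 (h.abs_approx_le t n)
  rw [abs_le]
  refine ⟨le_limsup_of_frequently_le (Frequently.of_forall fun n => (hb n).1)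
    ⟨_, eventually_map.2 (Eventually.of_forall fun n => (hb n).2)⟩,
    limsup_le_of_le ⟨-Real.sqrt (Real.exp (4 * G t) - 1), ?_⟩
      (Eventually.of_forall fun n => (hb n).2)⟩
  intro a ha
  obtain ⟨n, hn⟩ := (eventually_map.1 ha).exists
  exact (hb n).1.trans hn

/-- A continuous monotone map commutes with limsups of bounded sequences, and the semigroup property
sends the approximations at time `s` to those at time `t` once `1/(n+1) ≤ s`. -/
lemma flow_upperTrajectory (h : IsLinearGrowthField v G g) {s t : ℝ} (hs : 0 < s) (hst : s ≤ t) :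
    flow v s t (upperTrajectory v s) = upperTrajectory v t := by
  have hb := fun n => abs_le.1 (h.abs_approx_le s n)
  rw [upperTrajectory, (h.monotone_flow hs hst).map_limsup_of_continuousAt _
    (h.continuous_flow hs hst).continuousAt
    ⟨_, eventually_map.2 (Eventually.of_forall fun n => (hb n).2)⟩
    (IsBoundedUnder.isCoboundedUnder_le
      ⟨_, eventually_map.2 (Eventually.of_forall fun n => (hb n).1)⟩)]
  refine limsup_congr ?_
  have hlim := tendsto_one_div_add_atTop_nhds_zero_nat (𝕜 := ℝ)
  filter_upwards [hlim.eventually_le_const hs] with n hn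
  simp only [Function.comp, if_pos hn, if_pos (hn.trans hst)]
  exact h.flow_flow (by positivity) hn hst 0

lemma upperTrajectory_zero (h : IsLinearGrowthField v G g) : upperTrajectory v 0 = 0 := by
  have := h.abs_upperTrajectory_le 0
  simpa [h.map_zero] using this

lemma isIntegralCurveOn_upperTrajectory (h : IsLinearGrowthField v G g) {s S : ℝ} (hs : 0 < s) :
    IsIntegralCurveOn (upperTrajectory v) v (Icc s S) := by
  intro t ht
  have e : ∀ r ∈ Icc s S, upperTrajectory v r = flow v s r (upperTrajectory v s) :=
    fun r hr => (h.flow_upperTrajectory hs hr.1).symm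
  have := h.isIntegralCurveOn_flow hs S (upperTrajectory v s) t ht
  simp only [← e t ht] at this
  exact this.congr e (e t ht)

lemma hasDerivAt_upperTrajectory (h : IsLinearGrowthField v G g) {t : ℝ} (ht : 0 < t) :
    HasDerivAt (upperTrajectory v) (v t (upperTrajectory v t)) t :=
  (h.isIntegralCurveOn_upperTrajectory (half_pos ht) (S := t + 1) t
    ⟨by linarith, by linarith⟩).hasDerivAt (Icc_mem_nhds (by linarith) (by linarith))

lemma continuousOn_upperTrajectory (h : IsLinearGrowthField v G g) :
    ContinuousOn (upperTrajectory v) (Ici 0) := by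
  intro t ht
  rcases eq_or_lt_of_le (mem_Ici.1 ht) with rfl | ht0
  -- Continuity at `0` is a squeeze by the bound uniform in the starting time, which vanishes with
  -- `G`.
  · rw [ContinuousWithinAt, h.upperTrajectory_zero, tendsto_zero_iff_abs_tendsto_zero]
    have hc : ContinuousWithinAt (fun t => Real.sqrt (Real.exp (4 * G t) - 1)) (Ici 0) 0 := by
      have := h.continuousOn 0 self_mem_Ici
      fun_prop
    have hlim : Tendsto (fun t => Real.sqrt (Real.exp (4 * G t) - 1)) (𝓝[Ici 0] 0) (𝓝 0) := by
      simpa [ContinuousWithinAt, h.map_zero] using hc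
    refine squeeze_zero' (Eventually.of_forall fun _ => abs_nonneg _) ?_ hlim
    exact Eventually.of_forall fun t => h.abs_upperTrajectory_le t
  · exact (h.hasDerivAt_upperTrajectory ht0).continuousAt.continuousWithinAt

lemma contDiffOn_upperTrajectory (h : IsLinearGrowthField v G g) {n : ℕ∞}
    (hv : ContDiffOn ℝ n (Function.uncurry v) (Ioi 0 ×ˢ univ)) :
    ContDiffOn ℝ n (upperTrajectory v) (Ioi 0) := by
  intro t ht
  have ht : 0 < t := ht
  have h1 := ODE.contDiffOn_enat_Icc_of_hasDerivWithinAt (u := univ) (n := n)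
    (hv.mono (prod_mono (fun r hr => (half_pos ht).trans_le hr.1) (subset_univ _)))
    (h.isIntegralCurveOn_upperTrajectory (half_pos ht) (S := t + 1)) (mapsTo_univ _ _)
  exact (h1.contDiffAt (Icc_mem_nhds (by linarith) (by linarith))).contDiffWithinAt

end IsLinearGrowthField

/-! ### Measurable dependence of the flow on a parameter, by Picard iteration. -/

lemma measurable_intervalIntegral_uncurry {Ω : Type*} [MeasurableSpace Ω] {f : Ω → ℝ → ℝ}
    (hf : Measurable (Function.uncurry f)) (s : ℝ) :
    Measurable (fun p : Ω × ℝ => ∫ τ in s..p.2, f p.1 τ) := by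
  -- An integral with a variable endpoint is a difference of integrals over sections of measurable
  -- planar sets, to which Fubini measurability applies.
  have key : ∀ A : Set (ℝ × ℝ), MeasurableSet A →
      Measurable (fun p : Ω × ℝ => ∫ τ in {τ | (τ, p.2) ∈ A}, f p.1 τ) := by
    intro A hA
    have hm : Measurable (fun q : (Ω × ℝ) × ℝ =>
        {τ | (τ, q.1.2) ∈ A}.indicator (f q.1.1) q.2) := by
      have : (fun q : (Ω × ℝ) × ℝ => {τ | (τ, q.1.2) ∈ A}.indicator (f q.1.1) q.2) =
          {q : (Ω × ℝ) × ℝ | (q.2, q.1.2) ∈ A}.indicator (fun q => f q.1.1 q.2) := by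
        ext q
        simp [indicator]
      rw [this]
      refine Measurable.indicator ?_ ?_
      · exact hf.comp (g := Function.uncurry f) (f := fun q : (Ω × ℝ) × ℝ => (q.1.1, q.2))
          (by fun_prop)
      · exact hA.preimage (f := fun q : (Ω × ℝ) × ℝ => (q.2, q.1.2)) (by fun_prop)
    have := (StronglyMeasurable.integral_prod_right' (ν := volume) hm.stronglyMeasurable).measurable
    convert this using 2 with p
    rw [← integral_indicator]
    exact hA.preimage (f := fun τ => (τ, p.2)) (by fun_prop)
  have h1 := key {q | s < q.1 ∧ q.1 ≤ q.2}
    ((measurableSet_lt measurable_const measurable_fst).inter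
      (measurableSet_le measurable_fst measurable_snd))
  have h2 := key {q | q.2 < q.1 ∧ q.1 ≤ s}
    ((measurableSet_lt measurable_snd measurable_fst).inter
      (measurableSet_le measurable_fst measurable_const))
  exact h1.sub h2

lemma measurable_picard_iterate {Ω : Type*} [MeasurableSpace Ω] {w : Ω → ℝ → ℝ → ℝ}
    (hw : Measurable (fun p : Ω × ℝ × ℝ => w p.1 p.2.1 p.2.2)) (s x : ℝ) (n : ℕ) :
    Measurable (fun p : Ω × ℝ => (ODE.picard (w p.1) s x)^[n] (fun _ => x) p.2) := by
  induction n with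
  | zero => simp
  | succ n ih =>
    simp only [Function.iterate_succ_apply', ODE.picard_apply]
    refine measurable_const.add (measurable_intervalIntegral_uncurry
      (f := fun ω τ => w ω τ ((ODE.picard (w ω) s x)^[n] (fun _ => x) τ)) ?_ s)
    exact hw.comp (measurable_fst.prodMk (measurable_snd.prodMk ih))

lemma continuousOn_picard_iterate {w : ℝ → ℝ → ℝ} {s S : ℝ} (hS : s ≤ S)
    (hc : ContinuousOn (Function.uncurry w) (Icc s S ×ˢ univ)) (x : ℝ) (n : ℕ) :
    ContinuousOn ((ODE.picard w s x)^[n] (fun _ => x)) (Icc s S) := by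
  induction n with
  | zero => simpa using continuousOn_const
  | succ n ih =>
    rw [Function.iterate_succ_apply']
    exact fun t ht => (ODE.hasDerivWithinAt_picard_Icc (left_mem_Icc.2 hS) hc ih
      (fun _ _ => mem_univ _) x ht).continuousWithinAt

/-- The iterates are compared with a solution already known to exist; each integration of the
Lipschitz bound supplies the next factor of the exponential series. -/
lemma abs_picard_iterate_sub_le {w : ℝ → ℝ → ℝ} {s S x : ℝ}
    (hc : ContinuousOn (Function.uncurry w) (Icc s S ×ˢ univ)) {K : ℝ≥0}
    (hK : ∀ t ∈ Icc s S, LipschitzWith K (w t)) {γ : ℝ → ℝ} (hx : γ s = x)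
    (hγ : IsIntegralCurveOn γ w (Icc s S)) {M : ℝ} (hM : ∀ t ∈ Icc s S, |x - γ t| ≤ M) (n : ℕ) :
    ∀ t ∈ Icc s S, |(ODE.picard w s x)^[n] (fun _ => x) t - γ t| ≤
      M * ((K : ℝ) * (t - s)) ^ n / n.factorial := by
  induction n with
  | zero => simpa using hM
  | succ n ih =>
    intro t ht
    have hsub : Icc s t ⊆ Icc s S := Icc_subset_Icc_right ht.2
    have hu : uIcc s t = Icc s t := uIcc_of_le ht.1
    have hct : ContinuousOn (Function.uncurry w) (uIcc s t ×ˢ univ) :=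
      hc.mono (prod_mono (hu ▸ hsub) Subset.rfl)
    have hgt : γ t = x + ∫ τ in s..t, w τ (γ τ) := by
      rw [← ODE.picard_apply, ← hx]
      refine (ODE.picard_eq_of_hasDerivAt (u := univ) hct ?_ (mapsTo_univ _ _)).symm
      rw [hu]
      exact hγ.mono hsub
    have hi1 : IntervalIntegrable (fun τ => w τ ((ODE.picard w s x)^[n] (fun _ => x) τ))
        volume s t := by
      refine (ODE.continuousOn_comp hct ?_ (mapsTo_univ _ _)).intervalIntegrable
      rw [hu]
      exact (continuousOn_picard_iterate (ht.1.trans ht.2) hc x n).mono hsub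
    have hi2 : IntervalIntegrable (fun τ => w τ (γ τ)) volume s t := by
      refine (ODE.continuousOn_comp hct ?_ (mapsTo_univ _ _)).intervalIntegrable
      rw [hu]
      exact hγ.continuousOn.mono hsub
    rw [Function.iterate_succ_apply', ODE.picard_apply, hgt, add_sub_add_left_eq_sub,
      ← intervalIntegral.integral_sub hi1 hi2]
    have hb : ∀ τ ∈ Icc s t, |w τ ((ODE.picard w s x)^[n] (fun _ => x) τ) - w τ (γ τ)| ≤
        K * (M * ((K : ℝ) * (τ - s)) ^ n / n.factorial) := by
      intro τ hτ
      have := (hK τ (hsub hτ)).dist_le_mul ((ODE.picard w s x)^[n] (fun _ => x) τ) (γ τ)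
      rw [Real.dist_eq, Real.dist_eq] at this
      exact this.trans (mul_le_mul_of_nonneg_left (ih τ (hsub hτ)) K.2)
    calc |∫ τ in s..t, (w τ ((ODE.picard w s x)^[n] (fun _ => x) τ) - w τ (γ τ))|
        ≤ ∫ τ in s..t, |w τ ((ODE.picard w s x)^[n] (fun _ => x) τ) - w τ (γ τ)| :=
          intervalIntegral.abs_integral_le_integral_abs ht.1
      _ ≤ ∫ τ in s..t, K * (M * ((K : ℝ) * (τ - s)) ^ n / n.factorial) :=
          intervalIntegral.integral_mono_on ht.1 (hi1.sub hi2).abs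
            (Continuous.intervalIntegrable (by fun_prop) _ _) hb
      _ = ∫ τ in s..t, (K * M * K ^ n / n.factorial) * (τ - s) ^ n := by
          congr 1
          ext τ
          rw [mul_pow]
          ring
      _ = _ := by
          rw [intervalIntegral.integral_const_mul,
            intervalIntegral.integral_comp_sub_right (fun τ => τ ^ n) s, integral_pow,
            Nat.factorial_succ]
          have : (n.factorial : ℝ) ≠ 0 := by positivity
          have : (n : ℝ) + 1 ≠ 0 := by positivity
          rw [sub_self, zero_pow n.succ_ne_zero, sub_zero, mul_pow]
          push_cast
          field_simp
          ring

lemma tendsto_picard_iterate {w : ℝ → ℝ → ℝ} {s S x : ℝ}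
    (hc : ContinuousOn (Function.uncurry w) (Icc s S ×ˢ univ)) {K : ℝ≥0}
    (hK : ∀ t ∈ Icc s S, LipschitzWith K (w t)) {γ : ℝ → ℝ} (hx : γ s = x)
    (hγ : IsIntegralCurveOn γ w (Icc s S)) {t : ℝ} (ht : t ∈ Icc s S) :
    Tendsto (fun n => (ODE.picard w s x)^[n] (fun _ => x) t) atTop (𝓝 (γ t)) := by
  obtain ⟨M, hM⟩ := isCompact_Icc.exists_bound_of_continuousOn
    (continuousOn_const.sub hγ.continuousOn : ContinuousOn (fun t => x - γ t) (Icc s S))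
  rw [tendsto_iff_dist_tendsto_zero]
  have hlim : Tendsto (fun n : ℕ => M * (((K : ℝ) * (t - s)) ^ n / n.factorial)) atTop (𝓝 0) := by
    simpa using (FloorSemiring.tendsto_pow_div_factorial_atTop ((K : ℝ) * (t - s))).const_mul M
  refine squeeze_zero (fun _ => dist_nonneg) (fun n => ?_) hlim
  rw [Real.dist_eq, ← mul_div_assoc]
  exact abs_picard_iterate_sub_le hc hK hx hγ hM n t ht

lemma measurable_flow {Ω : Type*} [MeasurableSpace Ω] {v : Ω → ℝ → ℝ → ℝ}
    (hv : Measurable (fun p : Ω × ℝ × ℝ => v p.1 p.2.1 p.2.2)) {G g : Ω → ℝ → ℝ}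
    (hf : ∀ ω, IsLinearGrowthField (v ω) (G ω) (g ω)) {s t : ℝ} (hs : 0 < s) (hst : s ≤ t)
    (x : ℝ) : Measurable (fun ω => flow (v ω) s t x) := by
  have hex := fun (N : ℕ) ω => (hf ω).exists_isIntegralCurveOn_clampField hs hst N.cast_nonneg x
  -- This choice carries no measurability in `ω`; it is recovered at time `t` from the limit of the
  -- Picard iterates.
  choose γ hx hγ using hex
  have hmeas : ∀ N, Measurable (fun ω => γ N ω t) := by
    intro N
    refine measurable_of_tendsto_metrizable (f := fun n ω =>
      (ODE.picard (clampField (v ω) N) s x)^[n] (fun _ => x) t) (fun n => ?_) ?_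
    · refine (measurable_picard_iterate (w := fun ω => clampField (v ω) N) ?_ s x n).comp
        (measurable_id.prodMk measurable_const)
      exact hv.comp (g := fun p : Ω × ℝ × ℝ => v p.1 p.2.1 p.2.2)
        (f := fun p : Ω × ℝ × ℝ => (p.1, p.2.1, max (-(N : ℝ)) (min N p.2.2))) (by fun_prop)
    · rw [tendsto_pi_nhds]
      intro ω
      obtain ⟨K, hK⟩ := (hf ω).exists_lipschitzWith_clampField hs t (N := N) N.cast_nonneg
      exact tendsto_picard_iterate (((hf ω).continuousOn_clampField N).mono
        (prod_mono (fun r hr => hs.trans_le hr.1) Subset.rfl)) hK (hx N ω) (hγ N ω)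
        (right_mem_Icc.2 hst)
  refine measurable_of_tendsto_metrizable hmeas ?_
  rw [tendsto_pi_nhds]
  intro ω
  -- For each `ω`, the truncated curve is the true one once `N` exceeds the a priori bound.
  refine tendsto_const_nhds.congr' ?_
  filter_upwards [tendsto_natCast_atTop_atTop.eventually_ge_atTop
    (Real.sqrt ((1 + |x| ^ 2) * Real.exp (4 * (G ω t - G ω s))))] with N hN
  have h1 := (hf ω).isIntegralCurveOn_of_clampField hs N.cast_nonneg (hγ N ω)
    (by rw [hx N ω]; exact hN)
  have h2 := (hf ω).flow_eq hs h1 (right_mem_Icc.2 hst)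
  rwa [hx N ω] at h2

lemma measurable_upperTrajectory {Ω : Type*} [MeasurableSpace Ω] {v : Ω → ℝ → ℝ → ℝ}
    (hv : Measurable (fun p : Ω × ℝ × ℝ => v p.1 p.2.1 p.2.2)) {G g : Ω → ℝ → ℝ}
    (hf : ∀ ω, IsLinearGrowthField (v ω) (G ω) (g ω)) (t : ℝ) :
    Measurable (fun ω => upperTrajectory (v ω) t) := by
  unfold upperTrajectory
  refine Measurable.limsup fun n => ?_
  by_cases h : 1 / ((n : ℝ) + 1) ≤ t
  · simp only [if_pos h]
    exact measurable_flow hv hf (by positivity) h 0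
  · simp only [if_neg h]
    exact measurable_const

/-! ### Gaussian moments of a path and smoothness of the potential. -/

lemma exists_one_add_sq_pow_mul_exp_le (m : ℕ) {δ : ℝ} (hδ : 0 < δ) :
    ∃ C, 0 < C ∧ ∀ y : ℝ, (1 + y ^ 2) ^ m * Real.exp (-(δ * y ^ 2)) ≤ C := by
  refine ⟨((m + 1) / δ) ^ m * Real.exp δ, by positivity, fun y => ?_⟩
  -- This is `u ≤ exp u`, scaled so that its `m`-th power costs an exponent at most `δ (1 + y²)`;
  -- using `m + 1` covers `m = 0`.
  have h1 : 1 + y ^ 2 ≤ (m + 1) / δ * Real.exp (δ / (m + 1) * (1 + y ^ 2)) := by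
    have := Real.add_one_le_exp (δ / (m + 1) * (1 + y ^ 2))
    calc 1 + y ^ 2 = (m + 1) / δ * (δ / (m + 1) * (1 + y ^ 2)) := by field_simp
      _ ≤ _ := by gcongr; linarith
  have h2 : m * (δ / (m + 1) * (1 + y ^ 2)) ≤ δ * (1 + y ^ 2) := by
    rw [← mul_assoc]
    gcongr
    rw [mul_div_assoc', div_le_iff₀ (by positivity)]
    nlinarith
  calc (1 + y ^ 2) ^ m * Real.exp (-(δ * y ^ 2))
      ≤ ((m + 1) / δ * Real.exp (δ / (m + 1) * (1 + y ^ 2))) ^ m * Real.exp (-(δ * y ^ 2)) := by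
        gcongr
    _ = ((m + 1) / δ) ^ m * Real.exp (m * (δ / (m + 1) * (1 + y ^ 2)) + -(δ * y ^ 2)) := by
        rw [mul_pow, ← Real.exp_nat_mul, Real.exp_add, mul_assoc]
    _ ≤ ((m + 1) / δ) ^ m * Real.exp δ := by
        gcongr
        linarith

/-- The weight `y ^ k * exp (β y - a y ^ 2)`, with parameter `p = (a, β)`. -/
noncomputable def gaussWeight (k : ℕ) (p : ℝ × ℝ) (y : ℝ) : ℝ :=
  y ^ k * Real.exp (p.2 * y - p.1 * y ^ 2)

/-- The moments of a path against the weights `y ^ k * exp (β y - a y ^ 2)`. -/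
noncomputable def gaussMoment (b : ℝ → ℝ) (k : ℕ) (p : ℝ × ℝ) : ℝ :=
  ∫ y, gaussWeight k p y * b y

lemma continuous_gaussWeight (k : ℕ) (p : ℝ × ℝ) : Continuous (gaussWeight k p) := by
  unfold gaussWeight
  fun_prop

lemma exists_abs_gaussWeight_le (k : ℕ) {c : ℝ} (hc : 0 < c) (R : ℝ) :
    ∃ C, 0 < C ∧ ∀ (p : ℝ × ℝ) (y : ℝ), c ≤ p.1 → |p.2| ≤ R →
      |gaussWeight k p y| * (1 + y ^ 2) ^ 3 ≤ C := by
  obtain ⟨C, hC0, hC⟩ := exists_one_add_sq_pow_mul_exp_le (k + 3) (half_pos hc)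
  refine ⟨Real.exp (R ^ 2 / (2 * c)) * C, by positivity, fun p y hp1 hp2 => ?_⟩
  have h1 : |y ^ k| ≤ (1 + y ^ 2) ^ k := by
    rw [abs_pow]
    gcongr
    rw [← sq_abs y]
    nlinarith [sq_nonneg (|y| - 1)]
  -- Half of the Gaussian decay absorbs the linear term.
  have h2 : p.2 * y - p.1 * y ^ 2 ≤ R ^ 2 / (2 * c) + -(c / 2 * y ^ 2) := by
    have h3 : p.2 * y ≤ R * |y| := by
      refine (le_abs_self _).trans ?_
      rw [abs_mul]
      gcongr
    have h4 : R * |y| ≤ R ^ 2 / (2 * c) + c / 2 * y ^ 2 := by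
      have : 0 ≤ (R - c * |y|) ^ 2 / (2 * c) := by positivity
      have e : (R - c * |y|) ^ 2 / (2 * c) = R ^ 2 / (2 * c) + c / 2 * y ^ 2 - R * |y| := by
        rw [← sq_abs y]
        field_simp
        ring
      linarith
    nlinarith [mul_le_mul_of_nonneg_right hp1 (sq_nonneg y)]
  calc |gaussWeight k p y| * (1 + y ^ 2) ^ 3
      = |y ^ k| * Real.exp (p.2 * y - p.1 * y ^ 2) * (1 + y ^ 2) ^ 3 := by
        rw [gaussWeight, abs_mul, Real.abs_exp]
    _ ≤ (1 + y ^ 2) ^ k * Real.exp (R ^ 2 / (2 * c) + -(c / 2 * y ^ 2)) * (1 + y ^ 2) ^ 3 := by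
        gcongr
    _ = Real.exp (R ^ 2 / (2 * c)) * ((1 + y ^ 2) ^ (k + 3) * Real.exp (-(c / 2 * y ^ 2))) := by
        rw [Real.exp_add]
        ring
    _ ≤ _ := by
        gcongr
        exact hC y

section Moments

variable {b : ℝ → ℝ}

lemma exists_abs_gaussWeight_mul_le (b : ℝ → ℝ) (k : ℕ) {c : ℝ} (hc : 0 < c) (R : ℝ) :
    ∃ C, ∀ (p : ℝ × ℝ) (y : ℝ), c ≤ p.1 → |p.2| ≤ R →
      |gaussWeight k p y * b y| ≤ C * |b y / (1 + y ^ 2) ^ 3| := by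
  obtain ⟨C, hC0, hC⟩ := exists_abs_gaussWeight_le k hc R
  refine ⟨C, fun p y h1 h2 => ?_⟩
  have hp : 0 < (1 + y ^ 2) ^ 3 := by positivity
  rw [abs_mul, abs_div, abs_of_pos hp]
  calc |gaussWeight k p y| * |b y|
      = |gaussWeight k p y| * (1 + y ^ 2) ^ 3 * (|b y| / (1 + y ^ 2) ^ 3) := by field_simp
    _ ≤ _ := by
      gcongr
      exact hC p y h1 h2

lemma integrable_gaussWeight_mul (hm : Measurable b)
    (hb : Integrable (fun y => b y / (1 + y ^ 2) ^ 3)) (k : ℕ) {p : ℝ × ℝ} (hp : 0 < p.1) :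
    Integrable (fun y => gaussWeight k p y * b y) := by
  obtain ⟨C, hC⟩ := exists_abs_gaussWeight_mul_le b k hp |p.2|
  exact (hb.abs.const_mul C).mono'
    ((continuous_gaussWeight k p).measurable.mul hm).aestronglyMeasurable
    (ae_of_all _ fun y => hC p y le_rfl le_rfl)

lemma hasFDerivAt_gaussWeight (k : ℕ) (p : ℝ × ℝ) (y : ℝ) :
    HasFDerivAt (fun p => gaussWeight k p y)
      (gaussWeight (k + 1) p y • ContinuousLinearMap.snd ℝ ℝ ℝ
        - gaussWeight (k + 2) p y • ContinuousLinearMap.fst ℝ ℝ ℝ) p := by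
  have h1 : HasFDerivAt (fun p : ℝ × ℝ => p.2 * y - p.1 * y ^ 2)
      (y • ContinuousLinearMap.snd ℝ ℝ ℝ - y ^ 2 • ContinuousLinearMap.fst ℝ ℝ ℝ) p :=
    (hasFDerivAt_snd.mul_const y).sub (hasFDerivAt_fst.mul_const (y ^ 2))
  refine (h1.exp.const_mul (y ^ k)).congr_fderiv ?_
  ext <;> simp [gaussWeight] <;> ring_nf

/-- The exponent is linear in the parameters, so differentiating only raises `k`, by 1 or 2. The
family of moments is closed under differentiation, which gives smoothness by induction for all `k`
together. -/
lemma hasFDerivAt_gaussMoment (hm : Measurable b)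
    (hb : Integrable (fun y => b y / (1 + y ^ 2) ^ 3)) (k : ℕ) {p : ℝ × ℝ} (hp : 0 < p.1) :
    HasFDerivAt (gaussMoment b k)
      (gaussMoment b (k + 1) p • ContinuousLinearMap.snd ℝ ℝ ℝ
        - gaussMoment b (k + 2) p • ContinuousLinearMap.fst ℝ ℝ ℝ) p := by
  obtain ⟨C₁, hC₁⟩ := exists_abs_gaussWeight_mul_le b (k + 1) (half_pos hp) (|p.2| + p.1 / 2)
  obtain ⟨C₂, hC₂⟩ := exists_abs_gaussWeight_mul_le b (k + 2) (half_pos hp) (|p.2| + p.1 / 2)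
  have hmeas : ∀ k q, AEStronglyMeasurable (fun y => gaussWeight k q y * b y) :=
    fun k q => ((continuous_gaussWeight k q).measurable.mul hm).aestronglyMeasurable
  have hi := fun k => integrable_gaussWeight_mul hm hb k hp
  have key := hasFDerivAt_integral_of_dominated_of_fderiv_le (μ := volume) (𝕜 := ℝ)
    (F := fun q y => gaussWeight k q y * b y)
    (F' := fun q y => (gaussWeight (k + 1) q y * b y) • ContinuousLinearMap.snd ℝ ℝ ℝ
        - (gaussWeight (k + 2) q y * b y) • ContinuousLinearMap.fst ℝ ℝ ℝ)
    (bound := fun y => C₁ * |b y / (1 + y ^ 2) ^ 3| + C₂ * |b y / (1 + y ^ 2) ^ 3|)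
    -- On this ball `a` stays above `p.1 / 2` and `β` stays bounded, so one dominating function
    -- serves.
    (Metric.ball_mem_nhds p (half_pos hp)) (Eventually.of_forall fun q => hmeas k q) (hi k)
    (((hmeas (k + 1) p).smul_const _).sub ((hmeas (k + 2) p).smul_const _))
    (ae_of_all _ fun y q hq => ?_) ((hb.abs.const_mul C₁).add (hb.abs.const_mul C₂))
    (ae_of_all _ fun y q _ => ?_)
  · refine key.congr_fderiv ?_
    rw [integral_sub ((hi (k + 1)).smul_const _) ((hi (k + 2)).smul_const _),
      integral_smul_const, integral_smul_const]
    rfl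
  · have hd : |q.1 - p.1| < p.1 / 2 ∧ |q.2 - p.2| < p.1 / 2 := by
      rw [Metric.mem_ball, Prod.dist_eq, max_lt_iff] at hq
      exact hq
    have hq1 : p.1 / 2 ≤ q.1 := by linarith [(abs_lt.1 hd.1).1]
    have hq2 : |q.2| ≤ |p.2| + p.1 / 2 := by linarith [abs_sub_abs_le_abs_sub q.2 p.2]
    refine (norm_sub_le _ _).trans (add_le_add ?_ ?_)
    · rw [norm_smul]
      exact (mul_le_of_le_one_right (norm_nonneg _) (ContinuousLinearMap.norm_snd_le ..)).trans
        (hC₁ q y hq1 hq2)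
    · rw [norm_smul]
      exact (mul_le_of_le_one_right (norm_nonneg _) (ContinuousLinearMap.norm_fst_le ..)).trans
        (hC₂ q y hq1 hq2)
  · refine ((hasFDerivAt_gaussWeight k q y).mul_const (b y)).congr_fderiv ?_
    rw [smul_sub, smul_smul, smul_smul, mul_comm (b y), mul_comm (b y)]

lemma contDiffOn_gaussMoment (hm : Measurable b)
    (hb : Integrable (fun y => b y / (1 + y ^ 2) ^ 3)) (n : ℕ) :
    ∀ k, ContDiffOn ℝ n (gaussMoment b k) (Ioi 0 ×ˢ univ) := by
  induction n with
  | zero =>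
    intro k
    exact contDiffOn_zero.2 fun p hp =>
      (hasFDerivAt_gaussMoment hm hb k hp.1).continuousAt.continuousWithinAt
  | succ n ih =>
    intro k
    push_cast
    rw [contDiffOn_succ_iff_fderiv_of_isOpen (isOpen_Ioi.prod isOpen_univ)]
    refine ⟨fun p hp => (hasFDerivAt_gaussMoment hm hb k hp.1).differentiableAt
      |>.differentiableWithinAt, by simp, ?_⟩
    exact (((ih (k + 1)).smul contDiffOn_const).sub ((ih (k + 2)).smul contDiffOn_const)).congr
      fun p hp => (hasFDerivAt_gaussMoment hm hb k hp.1).fderiv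

/-- Expanding the square puts the dependence on `y` in a Gaussian weight with `a = 1/(4t)` and `β =
x/(2t)`. -/
lemma heatKernel_sub_eq {t : ℝ} (ht : 0 < t) (x y : ℝ) :
    heatKernel t (x - y) = Real.exp (-x ^ 2 / (4 * t)) / Real.sqrt (4 * Real.pi * t) *
      gaussWeight 0 (1 / (4 * t), x / (2 * t)) y := by
  rw [heatKernel, gaussWeight, pow_zero, one_mul, div_mul_eq_mul_div, ← Real.exp_add]
  congr 2
  field_simp
  ring

lemma pow_mul_heatKernel_mul_eq {t : ℝ} (ht : 0 < t) (b : ℝ → ℝ) (k : ℕ) (x y : ℝ) :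
    y ^ k * heatKernel t (x - y) * b y =
      Real.exp (-x ^ 2 / (4 * t)) / Real.sqrt (4 * Real.pi * t) *
      (gaussWeight k (1 / (4 * t), x / (2 * t)) y * b y) := by
  rw [heatKernel_sub_eq ht, gaussWeight, gaussWeight]
  ring

lemma integrable_pow_mul_heatKernel_mul (hm : Measurable b)
    (hb : Integrable (fun y => b y / (1 + y ^ 2) ^ 3)) {t : ℝ} (ht : 0 < t) (k : ℕ) (x : ℝ) :
    Integrable (fun y => y ^ k * heatKernel t (x - y) * b y) := by
  simp only [pow_mul_heatKernel_mul_eq ht]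
  exact (integrable_gaussWeight_mul hm hb k (by simp [ht])).const_mul _

lemma integral_pow_mul_heatKernel_mul {t : ℝ} (ht : 0 < t) (b : ℝ → ℝ) (k : ℕ) (x : ℝ) :
    ∫ y, y ^ k * heatKernel t (x - y) * b y =
      Real.exp (-x ^ 2 / (4 * t)) / Real.sqrt (4 * Real.pi * t) *
      gaussMoment b k (1 / (4 * t), x / (2 * t)) := by
  simp only [pow_mul_heatKernel_mul_eq ht]
  rw [integral_const_mul, gaussMoment]

lemma potential_eq {t : ℝ} (ht : 0 < t) (b : ℝ → ℝ) (x : ℝ) :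
    potential b t x = Real.exp (-x ^ 2 / (4 * t)) / Real.sqrt (4 * Real.pi * t) *
      gaussMoment b 0 (1 / (4 * t), x / (2 * t)) := by
  rw [potential, if_pos ht, ← integral_pow_mul_heatKernel_mul ht b 0 x]
  simp

lemma contDiffOn_potential (hm : Measurable b)
    (hb : Integrable (fun y => b y / (1 + y ^ 2) ^ 3)) :
    ContDiffOn ℝ ((⊤ : ℕ∞) : WithTop ℕ∞) (Function.uncurry (potential b)) (Ioi 0 ×ˢ univ) := by
  have h1 : ContDiffOn ℝ ((⊤ : ℕ∞) : WithTop ℕ∞) (gaussMoment b 0) (Ioi 0 ×ˢ univ) :=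
    contDiffOn_infty.2 fun n => contDiffOn_gaussMoment hm hb n 0
  have hfst : ContDiffOn ℝ ((⊤ : ℕ∞) : WithTop ℕ∞) (fun p : ℝ × ℝ => p.1) (Ioi 0 ×ˢ univ) :=
    contDiff_fst.contDiffOn
  have hsnd : ContDiffOn ℝ ((⊤ : ℕ∞) : WithTop ℕ∞) (fun p : ℝ × ℝ => p.2) (Ioi 0 ×ˢ univ) :=
    contDiff_snd.contDiffOn
  have hpos : ∀ p ∈ Ioi (0 : ℝ) ×ˢ (univ : Set ℝ), 0 < p.1 := fun p hp => hp.1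
  have h2 : ContDiffOn ℝ ((⊤ : ℕ∞) : WithTop ℕ∞)
      (fun p : ℝ × ℝ => (1 / (4 * p.1), p.2 / (2 * p.1))) (Ioi 0 ×ˢ univ) :=
    (contDiffOn_const.div (contDiffOn_const.mul hfst)
      (fun p hp => (mul_pos four_pos (hpos p hp)).ne')).prodMk
      (hsnd.div (contDiffOn_const.mul hfst) (fun p hp => (mul_pos two_pos (hpos p hp)).ne'))
  have h3 := h1.comp h2 (fun p hp => ⟨by have := hpos p hp; simp [this], mem_univ _⟩)
  have h4 : ContDiffOn ℝ ((⊤ : ℕ∞) : WithTop ℕ∞)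
      (fun p : ℝ × ℝ => Real.exp (-p.2 ^ 2 / (4 * p.1)) / Real.sqrt (4 * Real.pi * p.1))
      (Ioi 0 ×ˢ univ) := by
    have hq : ∀ p ∈ Ioi (0 : ℝ) ×ˢ (univ : Set ℝ), 0 < 4 * Real.pi * p.1 :=
      fun p hp => by have := hpos p hp; positivity
    refine ContDiffOn.div (ContDiffOn.exp ((hsnd.pow 2).neg.div (contDiffOn_const.mul hfst)
      (fun p hp => (mul_pos four_pos (hpos p hp)).ne')))
      ((contDiffOn_const.mul hfst).sqrt fun p hp => (hq p hp).ne')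
      (fun p hp => (Real.sqrt_pos.2 (hq p hp)).ne')
  refine (h4.mul h3).congr fun p hp => ?_
  exact potential_eq (hpos p hp) b p.2

lemma contDiffOn_velocity (hm : Measurable b)
    (hb : Integrable (fun y => b y / (1 + y ^ 2) ^ 3)) :
    ContDiffOn ℝ ((⊤ : ℕ∞) : WithTop ℕ∞) (Function.uncurry (velocity b)) (Ioi 0 ×ˢ univ) := by
  have hV := contDiffOn_potential hm hb
  have ho : IsOpen (Ioi (0 : ℝ) ×ˢ (univ : Set ℝ)) := isOpen_Ioi.prod isOpen_univ
  have h1 := (hV.fderiv_of_isOpen ho (m := ((⊤ : ℕ∞) : WithTop ℕ∞)) (by simp)).clm_apply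
    (contDiffOn_const (c := ((0 : ℝ), (1 : ℝ))))
  refine h1.neg.congr fun p hp => ?_
  have hd : HasFDerivAt (Function.uncurry (potential b))
      (fderiv ℝ (Function.uncurry (potential b)) p) (p.1, p.2) :=
    ((hV.contDiffAt (ho.mem_nhds hp)).differentiableAt (by simp)).hasFDerivAt
  have := hd.comp_hasDerivAt p.2 ((hasDerivAt_const p.2 p.1).prodMk (hasDerivAt_id p.2))
  simp only [Function.uncurry, velocity]
  rw [← this.deriv]
  rfl

/-- Differentiation of the heat potential under the integral sign. -/
lemma hasDerivAt_potential (hm : Measurable b)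
    (hb : Integrable (fun y => b y / (1 + y ^ 2) ^ 3)) {t : ℝ} (ht : 0 < t) (x : ℝ) :
    HasDerivAt (fun z => potential b t z)
      (∫ y, (y - x) / (2 * t) * heatKernel t (x - y) * b y) x := by
  have h1 : HasDerivAt (fun z : ℝ => Real.exp (-z ^ 2 / (4 * t)) / Real.sqrt (4 * Real.pi * t))
      (-x / (2 * t) * (Real.exp (-x ^ 2 / (4 * t)) / Real.sqrt (4 * Real.pi * t))) x := by
    refine ((((hasDerivAt_pow 2 x).neg.div_const (4 * t)).exp).div_const _).congr_deriv ?_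
    push_cast
    field_simp
    norm_num
    ring_nf
  have h2 : HasDerivAt (fun z : ℝ => gaussMoment b 0 (1 / (4 * t), z / (2 * t)))
      (gaussMoment b 1 (1 / (4 * t), x / (2 * t)) / (2 * t)) x := by
    have := (hasFDerivAt_gaussMoment hm hb 0 (p := (1 / (4 * t), x / (2 * t)))
      (by simp [ht])).comp_hasDerivAt x
      ((hasDerivAt_const x (1 / (4 * t))).prodMk ((hasDerivAt_id x).div_const (2 * t)))
    refine this.congr_deriv ?_
    simp [div_eq_mul_inv]
  have h3 := h1.mul h2
  have e : (fun z => potential b t z) = (fun z : ℝ => Real.exp (-z ^ 2 / (4 * t)) /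
      Real.sqrt (4 * Real.pi * t)) * fun z : ℝ => gaussMoment b 0 (1 / (4 * t), z / (2 * t)) := by
    ext z
    exact potential_eq ht b z
  rw [e]
  refine h3.congr_deriv ?_
  have e2 : ∀ y, (y - x) / (2 * t) * heatKernel t (x - y) * b y =
      1 / (2 * t) * (y ^ 1 * heatKernel t (x - y) * b y)
        - x / (2 * t) * (y ^ 0 * heatKernel t (x - y) * b y) := fun y => by ring
  simp only [e2]
  rw [integral_sub ((integrable_pow_mul_heatKernel_mul hm hb ht 1 x).const_mul _)
    ((integrable_pow_mul_heatKernel_mul hm hb ht 0 x).const_mul _), integral_const_mul,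
    integral_const_mul, integral_pow_mul_heatKernel_mul ht, integral_pow_mul_heatKernel_mul ht]
  ring

lemma velocity_eq (hm : Measurable b) (hb : Integrable (fun y => b y / (1 + y ^ 2) ^ 3))
    {t : ℝ} (ht : 0 < t) (x : ℝ) :
    velocity b t x = -∫ y, (y - x) / (2 * t) * heatKernel t (x - y) * b y := by
  rw [velocity, (hasDerivAt_potential hm hb ht x).deriv]

end Moments

/-! ### From fractional Sobolev regularity to the growth of the velocity. -/

/-- The weighted Sobolev-type increment of a path, at a pair of points. -/
noncomputable def weightedIncrement (b : ℝ → ℝ) (p : ℝ × ℝ) : ℝ :=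
  (b p.1 - b p.2) ^ 8 / ((p.1 - p.2) ^ 4 * ((1 + p.1 ^ 2) * (1 + p.2 ^ 2)))

/-- Paths of polynomial growth in mean, with a weighted fractional Sobolev regularity. -/
structure IsTemperedPath (b : ℝ → ℝ) : Prop where
  measurable : Measurable b
  integrable : Integrable (fun y => b y / (1 + y ^ 2) ^ 3)
  integrable_increment : Integrable (weightedIncrement b)

lemma isTemperedPath_zero : IsTemperedPath (fun _ => 0) where
  measurable := measurable_const
  integrable := by simp
  integrable_increment := by
    unfold weightedIncrement
    simp

section HeatKernel

variable {t : ℝ}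

lemma heatKernel_nonneg (t x : ℝ) : 0 ≤ heatKernel t x := by
  unfold heatKernel
  positivity

lemma heatKernel_sub_eq_gaussianPDFReal (ht : 0 ≤ t) (x y : ℝ) :
    heatKernel t (x - y) = gaussianPDFReal x (2 * t.toNNReal) y := by
  rw [heatKernel, gaussianPDFReal]
  push_cast
  rw [div_eq_inv_mul, Real.coe_toNNReal t ht]
  congr 2 <;> ring_nf

lemma two_mul_toNNReal_ne_zero (ht : 0 < t) : (2 * t.toNNReal : ℝ≥0) ≠ 0 :=
  mul_ne_zero two_ne_zero (Real.toNNReal_pos.2 ht).ne'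

lemma integral_heatKernel_sub (ht : 0 < t) (x : ℝ) : ∫ y, heatKernel t (x - y) = 1 := by
  simp only [heatKernel_sub_eq_gaussianPDFReal ht.le]
  exact integral_gaussianPDFReal_eq_one x (two_mul_toNNReal_ne_zero ht)

lemma integrable_one_div_one_add_sq_pow : Integrable (fun y : ℝ => 1 / (1 + y ^ 2) ^ 3) := by
  refine integrable_inv_one_add_sq.mono'
    (Measurable.aestronglyMeasurable (by fun_prop)) (ae_of_all _ fun y => ?_)
  have h : (1 : ℝ) ≤ 1 + y ^ 2 := by nlinarith [sq_nonneg y]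
  rw [Real.norm_of_nonneg (by positivity), one_div]
  exact inv_anti₀ (by positivity) (le_self_pow₀ h (by norm_num))

lemma integrable_pow_mul_heatKernel (ht : 0 < t) (k : ℕ) (x : ℝ) :
    Integrable (fun y => y ^ k * heatKernel t (x - y)) := by
  simpa using integrable_pow_mul_heatKernel_mul measurable_const
    (b := fun _ => 1) integrable_one_div_one_add_sq_pow ht k x

lemma integrable_heatKernel_sub (ht : 0 < t) (x : ℝ) :
    Integrable (fun y => heatKernel t (x - y)) := by
  simpa using integrable_pow_mul_heatKernel ht 0 x

lemma integrable_sub_mul_heatKernel (ht : 0 < t) (x : ℝ) :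
    Integrable (fun y => (y - x) * heatKernel t (x - y)) := by
  refine ((integrable_pow_mul_heatKernel ht 1 x).sub
    ((integrable_pow_mul_heatKernel ht 0 x).const_mul x)).congr (ae_of_all _ fun y => ?_)
  simp only [Pi.sub_apply]
  ring

lemma integral_sub_mul_heatKernel (ht : 0 < t) (x : ℝ) :
    ∫ y, (y - x) * heatKernel t (x - y) = 0 := by
  have h1 : ∫ y, y ^ 1 * heatKernel t (x - y) = x := by
    refine Eq.trans ?_ (integral_id_gaussianReal (μ := x) (v := 2 * t.toNNReal))
    rw [integral_gaussianReal_eq_integral_smul (two_mul_toNNReal_ne_zero ht)]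
    refine integral_congr_ae (ae_of_all _ fun y => ?_)
    simp only [heatKernel_sub_eq_gaussianPDFReal ht.le, smul_eq_mul]
    ring
  have e : ∀ y, (y - x) * heatKernel t (x - y) =
    y ^ 1 * heatKernel t (x - y) - x * heatKernel t (x - y) := fun y => by ring
  simp only [e]
  rw [integral_sub (integrable_pow_mul_heatKernel ht 1 x)
    ((integrable_heatKernel_sub ht x).const_mul x), integral_const_mul, h1,
    integral_heatKernel_sub ht]
  ring

lemma integrable_sub_sq_mul_heatKernel (ht : 0 < t) (x : ℝ) :
    Integrable (fun y => (y - x) ^ 2 * heatKernel t (x - y)) := by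
  refine (((integrable_pow_mul_heatKernel ht 2 x).sub
    ((integrable_pow_mul_heatKernel ht 1 x).const_mul (2 * x))).add
    ((integrable_pow_mul_heatKernel ht 0 x).const_mul (x ^ 2))).congr (ae_of_all _ fun y => ?_)
  simp only [Pi.sub_apply, Pi.add_apply]
  ring

lemma integral_sub_sq_mul_heatKernel (ht : 0 < t) (x : ℝ) :
    ∫ y, (y - x) ^ 2 * heatKernel t (x - y) = 2 * t := by
  have h1 := variance_fun_id_gaussianReal (μ := x) (v := 2 * t.toNNReal)
  rw [variance_eq_integral (by fun_prop), integral_id_gaussianReal,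
    integral_gaussianReal_eq_integral_smul (two_mul_toNNReal_ne_zero ht)] at h1
  have h2 : ((2 * t.toNNReal : ℝ≥0) : ℝ) = 2 * t := by
    rw [NNReal.coe_mul, Real.coe_toNNReal t ht.le]
    rfl
  rw [← h2, ← h1]
  refine integral_congr_ae (ae_of_all _ fun y => ?_)
  simp only [heatKernel_sub_eq_gaussianPDFReal ht.le, smul_eq_mul]
  ring

lemma integrable_abs_sub_mul_heatKernel (ht : 0 < t) (x : ℝ) :
    Integrable (fun y => |y - x| * heatKernel t (x - y)) := by
  refine (integrable_sub_mul_heatKernel ht x).abs.congr (ae_of_all _ fun y => ?_)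
  simp only [abs_mul, abs_of_nonneg (heatKernel_nonneg _ _)]

lemma integral_abs_sub_mul_heatKernel_le {θ : ℝ} (hθ : 0 < θ) (x : ℝ) :
    ∫ y, |y - x| * heatKernel (θ ^ 2) (x - y) ≤ 3 * θ := by
  have ht : 0 < θ ^ 2 := by positivity
  have h : ∀ y, |y - x| * heatKernel (θ ^ 2) (x - y) ≤
      θ * heatKernel (θ ^ 2) (x - y) + 1 / θ * ((y - x) ^ 2 * heatKernel (θ ^ 2) (x - y)) := by
    intro y
    have h1 : |y - x| ≤ θ + 1 / θ * (y - x) ^ 2 := by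
      -- With second moment `2θ²`, this splitting yields `θ + 2θ`.
      rw [← sq_abs (y - x), div_mul_eq_mul_div, one_mul, ← sub_le_iff_le_add', le_div_iff₀ hθ]
      nlinarith [sq_nonneg (|y - x| - θ), abs_nonneg (y - x)]
    calc _ ≤ (θ + 1 / θ * (y - x) ^ 2) * heatKernel (θ ^ 2) (x - y) :=
          mul_le_mul_of_nonneg_right h1 (heatKernel_nonneg _ _)
      _ = _ := by ring
  have h2 := integral_mono (integrable_abs_sub_mul_heatKernel ht x)
    (((integrable_heatKernel_sub ht x).const_mul θ).add
    ((integrable_sub_sq_mul_heatKernel ht x).const_mul (1 / θ))) h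
  refine h2.trans (le_of_eq ?_)
  simp only [Pi.add_apply]
  rw [integral_add ((integrable_heatKernel_sub ht x).const_mul θ)
    ((integrable_sub_sq_mul_heatKernel ht x).const_mul (1 / θ)), integral_const_mul,
    integral_const_mul, integral_heatKernel_sub ht, integral_sub_sq_mul_heatKernel ht]
  field_simp
  ring

/-- Scaling `r = θρ`, `s = θσ` gives `θ` from `|r|`, `θ⁻²` from the two kernels and `θ⁴` from `(r -
s)^4`; the Gaussian factors absorb the polynomials in `ρ` and `σ`. -/
lemma exists_heatKernel_weight_le :
    ∃ C, 0 < C ∧ ∀ (θ x r s : ℝ), 0 < θ →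
      |r| * heatKernel (θ ^ 2) r * heatKernel (θ ^ 2) s *
        ((r - s) ^ 4 * ((1 + (x - r) ^ 2) * (1 + (x - s) ^ 2))) ≤
      C * θ ^ 3 * (1 + |x| + θ) ^ 4 := by
  obtain ⟨C, hC0, hC⟩ := exists_one_add_sq_pow_mul_exp_le 4 (δ := 1 / 4) (by norm_num)
  refine ⟨64 * C ^ 2, by positivity, fun θ x r s hθ => ?_⟩
  set M := 1 + |x| + θ with hM
  obtain ⟨ρ, rfl⟩ : ∃ ρ, r = θ * ρ := ⟨r / θ, by field_simp⟩
  obtain ⟨σ, rfl⟩ : ∃ σ, s = θ * σ := ⟨s / θ, by field_simp⟩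
  have hx := abs_nonneg x
  have hk : ∀ ρ : ℝ, heatKernel (θ ^ 2) (θ * ρ) ≤ Real.exp (-(1 / 4 * ρ ^ 2)) / θ := by
    intro ρ
    have e : -(θ * ρ) ^ 2 / (4 * θ ^ 2) = -(1 / 4 * ρ ^ 2) := by field_simp
    rw [heatKernel, e]
    gcongr
    refine Real.le_sqrt_of_sq_le ?_
    nlinarith [Real.pi_gt_three, sq_nonneg θ]
  have hw : ∀ ρ : ℝ, 1 + (x - θ * ρ) ^ 2 ≤ 2 * M ^ 2 * (1 + ρ ^ 2) := by
    intro ρ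
    have h1 : (x - θ * ρ) ^ 2 ≤ 2 * |x| ^ 2 + 2 * (θ ^ 2 * ρ ^ 2) := by
      rw [sq_abs]
      nlinarith [sq_nonneg (x + θ * ρ)]
    have h2 : 1 + |x| ^ 2 + θ ^ 2 ≤ M ^ 2 := by
      rw [hM]
      nlinarith [mul_nonneg hx hθ.le]
    have h3 : θ ^ 2 * ρ ^ 2 + (1 + |x| ^ 2) ≤ M ^ 2 * (1 + ρ ^ 2) := by
      nlinarith [mul_le_mul_of_nonneg_right h2 (sq_nonneg ρ),
        mul_nonneg (sq_nonneg |x|) (sq_nonneg ρ), sq_nonneg ρ, sq_nonneg θ]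
    nlinarith
  have hd : (θ * ρ - θ * σ) ^ 4 ≤ 16 * θ ^ 4 * ((1 + ρ ^ 2) ^ 2 * (1 + σ ^ 2) ^ 2) := by
    have h1 : (ρ - σ) ^ 2 ≤ 4 * ((1 + ρ ^ 2) * (1 + σ ^ 2)) := by
      nlinarith [sq_nonneg (ρ + σ), mul_nonneg (sq_nonneg ρ) (sq_nonneg σ),
        sq_nonneg ρ, sq_nonneg σ]
    calc (θ * ρ - θ * σ) ^ 4 = θ ^ 4 * ((ρ - σ) ^ 2) ^ 2 := by ring
      _ ≤ θ ^ 4 * (4 * ((1 + ρ ^ 2) * (1 + σ ^ 2))) ^ 2 := by gcongr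
      _ = _ := by ring
  have ha : |θ * ρ| ≤ θ * (1 + ρ ^ 2) := by
    rw [abs_mul, abs_of_pos hθ]
    gcongr
    rw [← sq_abs ρ]
    nlinarith [sq_nonneg (|ρ| - 1)]
  have hσ : (1 + σ ^ 2) ^ 3 * Real.exp (-(1 / 4 * σ ^ 2)) ≤ C := by
    refine le_trans ?_ (hC σ)
    gcongr
    · nlinarith [sq_nonneg σ]
    · norm_num
  calc _ ≤ (θ * (1 + ρ ^ 2)) * (Real.exp (-(1 / 4 * ρ ^ 2)) / θ) *
        (Real.exp (-(1 / 4 * σ ^ 2)) / θ) *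
        ((16 * θ ^ 4 * ((1 + ρ ^ 2) ^ 2 * (1 + σ ^ 2) ^ 2)) *
        ((2 * M ^ 2 * (1 + ρ ^ 2)) * (2 * M ^ 2 * (1 + σ ^ 2)))) := by
        gcongr
        · exact heatKernel_nonneg _ _
        · exact heatKernel_nonneg _ _
        · exact hk ρ
        · exact hk σ
        · exact hw ρ
        · exact hw σ
    _ = 64 * θ ^ 3 * M ^ 4 * (((1 + ρ ^ 2) ^ 4 * Real.exp (-(1 / 4 * ρ ^ 2))) *
        ((1 + σ ^ 2) ^ 3 * Real.exp (-(1 / 4 * σ ^ 2)))) := by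
        field_simp
        ring
    _ ≤ 64 * θ ^ 3 * M ^ 4 * (C * C) := by
        gcongr
        exact hC ρ
    _ = _ := by ring

end HeatKernel

lemma abs_le_add_pow_div {l : ℝ} (hl : 0 < l) (d : ℝ) : |d| ≤ l + d ^ 8 / l ^ 7 := by
  rcases le_total |d| l with h | h
  · have : 0 ≤ d ^ 8 / l ^ 7 := by positivity
    linarith
  · have h1 : |d| ≤ d ^ 8 / l ^ 7 := by
      rw [le_div_iff₀ (by positivity)]
      calc |d| * l ^ 7 ≤ |d| * |d| ^ 7 := by gcongr
        _ = |d| ^ 8 := by ring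
        _ = d ^ 8 := by rw [Even.pow_abs (by decide)]
    linarith

namespace IsTemperedPath

variable {b : ℝ → ℝ}

lemma sub_pow_eq (b : ℝ → ℝ) (y z : ℝ) : (b y - b z) ^ 8 =
    weightedIncrement b (y, z) * ((y - z) ^ 4 * ((1 + y ^ 2) * (1 + z ^ 2))) := by
  -- On the diagonal the quotient is `0` by convention and both sides vanish.
  rcases eq_or_ne y z with rfl | h
  · simp
  · have := sub_ne_zero.2 h
    rw [weightedIncrement, div_mul_cancel₀]
    positivity

/-- The kernel has mass one and zero first moment about `x`, so averaging `b z` against it and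
subtracting changes nothing. Only increments of the path remain. -/
lemma velocity_eq_integral_prod (hb : IsTemperedPath b) {t : ℝ} (ht : 0 < t) (x : ℝ) :
    velocity b t x = -(1 / (2 * t) * ∫ p : ℝ × ℝ, (p.1 - x) * heatKernel t (x - p.1) *
      heatKernel t (x - p.2) * (b p.1 - b p.2)) := by
  have hi0 : Integrable (fun y => heatKernel t (x - y) * b y) := by
    simpa using integrable_pow_mul_heatKernel_mul hb.measurable hb.integrable ht 0 x
  have hi1 : Integrable (fun y => (y - x) * heatKernel t (x - y) * b y) := by
    refine ((integrable_pow_mul_heatKernel_mul hb.measurable hb.integrable ht 1 x).sub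
      ((integrable_pow_mul_heatKernel_mul hb.measurable hb.integrable ht 0 x).const_mul x)).congr
      (ae_of_all _ fun y => ?_)
    simp only [Pi.sub_apply]
    ring
  have e : ∀ p : ℝ × ℝ, (p.1 - x) * heatKernel t (x - p.1) * heatKernel t (x - p.2) *
      (b p.1 - b p.2) =
      ((p.1 - x) * heatKernel t (x - p.1) * b p.1) * heatKernel t (x - p.2) -
      ((p.1 - x) * heatKernel t (x - p.1)) * (heatKernel t (x - p.2) * b p.2) :=
    fun p => by ring
  simp only [e]
  rw [velocity_eq hb.measurable hb.integrable ht, Measure.volume_eq_prod,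
    integral_sub (hi1.mul_prod (integrable_heatKernel_sub ht x))
      ((integrable_sub_mul_heatKernel ht x).mul_prod hi0),
    integral_prod_mul (fun y => (y - x) * heatKernel t (x - y) * b y)
      (fun z => heatKernel t (x - z)),
    integral_prod_mul (fun y => (y - x) * heatKernel t (x - y))
      (fun z => heatKernel t (x - z) * b z),
    integral_heatKernel_sub ht, integral_sub_mul_heatKernel ht, zero_mul, sub_zero, mul_one,
    ← integral_const_mul]
  congr 2
  ext y
  ring

/-- With `t = α^8` and kernel scale `θ = α^4`, each increment is split at a level `l` by `|d| ≤ l +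
d^8 / l^7`. The first term contributes order `l / α^4`, the second order `α^4 M^4 / l^7`. -/
lemma exists_abs_velocity_le (hb : IsTemperedPath b) :
    ∃ C, 0 < C ∧ ∀ α x : ℝ, 0 < α →
      |velocity b (α ^ 8) x| ≤ C * (1 + |x| + α ^ 4) / α ^ 3 := by
  obtain ⟨C, hC0, hC⟩ := exists_heatKernel_weight_le
  set J := ∫ p, weightedIncrement b p with hJ
  have hD0 : ∀ p, 0 ≤ weightedIncrement b p := fun p => by
    unfold weightedIncrement
    positivity
  have hJ0 : 0 ≤ J := integral_nonneg hD0
  refine ⟨2 + C * J, by positivity, fun α x hα => ?_⟩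
  have hθ : 0 < α ^ 4 := by positivity
  have e8 : α ^ 8 = (α ^ 4) ^ 2 := by ring
  have ht : 0 < (α ^ 4) ^ 2 := by positivity
  rw [e8, hb.velocity_eq_integral_prod ht, abs_neg, abs_mul,
    abs_of_pos (by positivity : 0 < 1 / (2 * (α ^ 4) ^ 2))]
  set M := 1 + |x| + α ^ 4 with hM
  have hM1 : 1 ≤ M := by
    have := abs_nonneg x
    linarith
  have hMpos : 0 < M := by linarith
  -- This level makes both contributions of order `α⁻³` and leaves growth linear in `M`.
  set l := α * M with hl
  have hl0 : 0 < l := by positivity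
  have hbound : ∀ p : ℝ × ℝ, ‖(p.1 - x) * heatKernel ((α ^ 4) ^ 2) (x - p.1) *
      heatKernel ((α ^ 4) ^ 2) (x - p.2) * (b p.1 - b p.2)‖ ≤
      l * ((|p.1 - x| * heatKernel ((α ^ 4) ^ 2) (x - p.1)) *
        heatKernel ((α ^ 4) ^ 2) (x - p.2)) +
      C * (α ^ 4) ^ 3 * M ^ 4 / l ^ 7 * weightedIncrement b p := by
    rintro ⟨y, z⟩
    have h1 := abs_le_add_pow_div hl0 (b y - b z)
    have h2 := hC (α ^ 4) x (x - y) (x - z) hθ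
    have hn1 := heatKernel_nonneg ((α ^ 4) ^ 2) (x - y)
    have hn2 := heatKernel_nonneg ((α ^ 4) ^ 2) (x - z)
    rw [sub_pow_eq] at h1
    simp only [sub_sub_cancel, sub_sub_sub_cancel_left] at h2
    rw [abs_sub_comm x y, show (z - y) ^ 4 = (y - z) ^ 4 by ring] at h2
    simp only [norm_mul, Real.norm_eq_abs]
    rw [abs_of_nonneg hn1, abs_of_nonneg hn2]
    calc _ ≤ |y - x| * heatKernel ((α ^ 4) ^ 2) (x - y) * heatKernel ((α ^ 4) ^ 2) (x - z) *
          (l + weightedIncrement b (y, z) * ((y - z) ^ 4 * ((1 + y ^ 2) * (1 + z ^ 2))) / l ^ 7) :=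
          mul_le_mul_of_nonneg_left h1 (by positivity)
      _ = l * ((|y - x| * heatKernel ((α ^ 4) ^ 2) (x - y)) * heatKernel ((α ^ 4) ^ 2) (x - z)) +
          (|y - x| * heatKernel ((α ^ 4) ^ 2) (x - y) * heatKernel ((α ^ 4) ^ 2) (x - z) *
          ((y - z) ^ 4 * ((1 + y ^ 2) * (1 + z ^ 2)))) / l ^ 7 * weightedIncrement b (y, z) := by
          ring
      _ ≤ _ := by
          gcongr
          exact hD0 _
  have hi1 : Integrable (fun p : ℝ × ℝ => l * ((|p.1 - x| * heatKernel ((α ^ 4) ^ 2) (x - p.1)) *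
        heatKernel ((α ^ 4) ^ 2) (x - p.2))) :=
    ((integrable_abs_sub_mul_heatKernel ht x).mul_prod
      (integrable_heatKernel_sub ht x)).const_mul l
  have hi2 := hb.integrable_increment.const_mul (C * (α ^ 4) ^ 3 * M ^ 4 / l ^ 7)
  have h3 := norm_integral_le_of_norm_le (hi1.add hi2) (ae_of_all _ hbound)
  simp only [Pi.add_apply] at h3
  rw [integral_add hi1 hi2, integral_const_mul, integral_const_mul, ← hJ,
    Measure.volume_eq_prod,
    integral_prod_mul (fun y => |y - x| * heatKernel ((α ^ 4) ^ 2) (x - y))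
      (fun z => heatKernel ((α ^ 4) ^ 2) (x - z)), integral_heatKernel_sub ht, mul_one,
    Real.norm_eq_abs] at h3
  have h4 := integral_abs_sub_mul_heatKernel_le hθ x
  calc _ ≤ 1 / (2 * (α ^ 4) ^ 2) * (l * (3 * α ^ 4) +
        C * (α ^ 4) ^ 3 * M ^ 4 / l ^ 7 * J) := by
        gcongr
        exact h3.trans (by gcongr)
    _ = (3 / 2 * M + C * J / 2 / M ^ 3) / α ^ 3 := by
        rw [hl]
        field_simp
    _ ≤ _ := by
        gcongr
        have h5 : C * J / 2 / M ^ 3 ≤ C * J * M := by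
          rw [div_div, div_le_iff₀ (by positivity)]
          have : 1 ≤ M * (2 * M ^ 3) := by
            nlinarith [one_le_pow₀ hM1 (n := 4)]
          nlinarith [mul_nonneg hC0.le hJ0]
        nlinarith

end IsTemperedPath

/-- The velocity field at positive times, extended by `0` to nonpositive times. -/
noncomputable def forwardVelocity (b : ℝ → ℝ) (t x : ℝ) : ℝ := if 0 < t then velocity b t x else 0

lemma forwardVelocity_of_pos (b : ℝ → ℝ) {t : ℝ} (ht : 0 < t) (x : ℝ) :
    forwardVelocity b t x = velocity b t x := if_pos ht

lemma IsTemperedPath.contDiffOn_forwardVelocity {b : ℝ → ℝ} (hb : IsTemperedPath b) :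
    ContDiffOn ℝ ((⊤ : ℕ∞) : WithTop ℕ∞) (Function.uncurry (forwardVelocity b))
      (Ioi 0 ×ˢ univ) :=
  (contDiffOn_velocity hb.measurable hb.integrable).congr
    fun p hp => forwardVelocity_of_pos b hp.1 p.2

lemma IsTemperedPath.exists_isLinearGrowthField {b : ℝ → ℝ} (hb : IsTemperedPath b) :
    ∃ G g, IsLinearGrowthField (forwardVelocity b) G g := by
  obtain ⟨C, hC0, hC⟩ := hb.exists_abs_velocity_le
  -- Since `M ≤ (1 + α^4)(1 + |x|)`, the rate is `α⁻³ + α` with `α = t^(1/8)`; the first function is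
  -- its primitive.
  refine ⟨fun t => C * (8 / 5 * t ^ (5 / 8 : ℝ) + 8 / 9 * t ^ (9 / 8 : ℝ)),
    fun t => C * (t ^ (-3 / 8 : ℝ) + t ^ (1 / 8 : ℝ)), ?_, ?_, ?_, ?_, ?_⟩
  · exact hb.contDiffOn_forwardVelocity.of_le (by exact_mod_cast le_top)
  · intro t ht
    have h1 := Real.hasDerivAt_rpow_const (x := t) (p := 5 / 8) (Or.inl ht.ne')
    have h2 := Real.hasDerivAt_rpow_const (x := t) (p := 9 / 8) (Or.inl ht.ne')
    refine (((h1.const_mul (8 / 5)).add (h2.const_mul (8 / 9))).const_mul C).congr_deriv ?_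
    rw [← mul_assoc, ← mul_assoc]
    norm_num
  · refine ContinuousOn.mul continuousOn_const (ContinuousOn.add ?_ ?_) <;>
      refine ContinuousOn.mul continuousOn_const (Continuous.continuousOn ?_) <;>
      exact Real.continuous_rpow_const (by norm_num)
  · norm_num
  · intro t ht x
    set α := t ^ (1 / 8 : ℝ) with hα
    have hα0 : 0 < α := Real.rpow_pos_of_pos ht _
    have hα8 : α ^ 8 = t := by
      rw [hα, ← Real.rpow_natCast, ← Real.rpow_mul ht.le]
      norm_num
    have hα3 : t ^ (-3 / 8 : ℝ) = (α ^ 3)⁻¹ := by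
      rw [hα, ← Real.rpow_natCast, ← Real.rpow_mul ht.le, ← Real.rpow_neg ht.le]
      norm_num
    have h := hC α x hα0
    rw [hα8] at h
    rw [forwardVelocity_of_pos b ht, hα3]
    refine h.trans ?_
    have hx := abs_nonneg x
    calc C * (1 + |x| + α ^ 4) / α ^ 3 ≤ C * ((1 + α ^ 4) * (1 + |x|)) / α ^ 3 := by
          gcongr
          nlinarith [mul_nonneg (pow_pos hα0 4).le hx]
      _ = _ := by field_simp

/-! ### Brownian paths are almost surely tempered. -/

section Probability

variable {Ω : Type*} [MeasurableSpace Ω] {P : Measure Ω}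

lemma measurable_heatKernel : Measurable (Function.uncurry heatKernel) := by
  unfold heatKernel
  simp only [Function.uncurry_def]
  fun_prop

/-- Joint measurability is read off the integral formula for the velocity, valid at positive times,
rather than off `deriv`. -/
lemma measurable_forwardVelocity {W : ℝ → Ω → ℝ} (hW : Measurable (Function.uncurry W))
    (hT : ∀ ω, IsTemperedPath (fun x => W x ω)) :
    Measurable (fun p : Ω × ℝ × ℝ => forwardVelocity (fun x => W x p.1) p.2.1 p.2.2) := by
  have e : (fun p : Ω × ℝ × ℝ => forwardVelocity (fun x => W x p.1) p.2.1 p.2.2) =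
      {p : Ω × ℝ × ℝ | 0 < p.2.1}.indicator (fun p => -∫ y, (y - p.2.2) / (2 * p.2.1) *
        heatKernel p.2.1 (p.2.2 - y) * W y p.1) := by
    ext p
    by_cases hp : 0 < p.2.1
    · rw [indicator_of_mem (by exact hp), forwardVelocity_of_pos _ hp,
        velocity_eq (hT p.1).measurable (hT p.1).integrable hp]
    · rw [indicator_of_notMem (by exact hp), forwardVelocity, if_neg hp]
  rw [e]
  refine Measurable.indicator ?_ (measurableSet_lt measurable_const (by fun_prop))
  have hm : Measurable (fun q : (Ω × ℝ × ℝ) × ℝ => (q.2 - q.1.2.2) / (2 * q.1.2.1) *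
      heatKernel q.1.2.1 (q.1.2.2 - q.2) * W q.2 q.1.1) := by
    refine Measurable.mul (Measurable.mul (by fun_prop) ?_) ?_
    · exact measurable_heatKernel.comp
        (f := fun q : (Ω × ℝ × ℝ) × ℝ => (q.1.2.1, q.1.2.2 - q.2)) (by fun_prop)
    · exact hW.comp (f := fun q : (Ω × ℝ × ℝ) × ℝ => (q.2, q.1.1)) (by fun_prop)
  exact (StronglyMeasurable.integral_prod_right' (ν := volume)
    hm.stronglyMeasurable).measurable.neg

/-- Tonelli's theorem for a nonnegative random field dominated in mean by an integrable
function. -/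
lemma ae_integrable_of_lintegral_le {E : Type*} [MeasurableSpace E] {μ : Measure E} [SFinite μ]
    [SFinite P] {f : Ω → E → ℝ} (hf : Measurable (Function.uncurry f)) (hf0 : ∀ ω e, 0 ≤ f ω e)
    {w : E → ℝ} (hw : Integrable w μ)
    (hfw : ∀ e, ∫⁻ ω, ENNReal.ofReal (f ω e) ∂P ≤ ENNReal.ofReal (w e)) :
    ∀ᵐ ω ∂P, Integrable (f ω) μ := by
  have hm : Measurable (Function.uncurry fun ω e => ENNReal.ofReal (f ω e)) := hf.ennreal_ofReal
  have hfin : ∫⁻ ω, ∫⁻ e, ENNReal.ofReal (f ω e) ∂μ ∂P ≠ ⊤ := by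
    rw [lintegral_lintegral_swap hm.aemeasurable]
    refine ne_top_of_le_ne_top ?_ (lintegral_mono hfw)
    exact hw.lintegral_lt_top.ne
  filter_upwards [ae_lt_top hm.lintegral_prod_right' hfin] with ω hω
  refine ⟨(hf.comp measurable_prodMk_left).aestronglyMeasurable, ?_⟩
  rw [hasFiniteIntegral_iff_ofReal (ae_of_all _ (hf0 ω))]
  exact hω

lemma exists_lintegral_gaussianReal_pow_eight_le :
    ∃ C : ℝ, 0 < C ∧ ∀ v : ℝ≥0, ∫⁻ x, ENNReal.ofReal (x ^ 8) ∂(gaussianReal 0 v) ≤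
      ENNReal.ofReal (C * (v : ℝ) ^ 4) := by
  have hint : Integrable (fun x : ℝ => x ^ 8) (gaussianReal 0 1) := by
    have h := (memLp_id_gaussianReal (μ := 0) (v := 1) 8).integrable_norm_pow (by norm_num)
    refine h.congr (ae_of_all _ fun x => ?_)
    simp [Even.pow_abs (show Even 8 by decide)]
  refine ⟨1 + ∫ x, x ^ 8 ∂(gaussianReal 0 1), ?_, fun v => ?_⟩
  · have : 0 ≤ ∫ x, x ^ 8 ∂(gaussianReal 0 1) := integral_nonneg fun x => by positivity
    linarith
  · have hlaw : gaussianReal 0 v = (gaussianReal 0 1).map (Real.sqrt v * ·) := by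
      rw [gaussianReal_map_const_mul]
      congr 1
      · simp
      · ext
        simp
    rw [hlaw, lintegral_map (by fun_prop) (by fun_prop)]
    have e : ∀ x : ℝ, (Real.sqrt v * x) ^ 8 = (v : ℝ) ^ 4 * x ^ 8 := fun x => by
      rw [mul_pow, show Real.sqrt v ^ 8 = (Real.sqrt v ^ 2) ^ 4 by ring, Real.sq_sqrt v.coe_nonneg]
    simp only [e]
    rw [← ofReal_integral_eq_lintegral_ofReal (hint.const_mul _)
      (ae_of_all _ fun x => by positivity), integral_const_mul, mul_comm]
    refine ENNReal.ofReal_le_ofReal ?_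
    gcongr
    linarith

/-- The factor `(y - z)^4` from the moment bound cancels the singular denominator, leaving an
integrable weight on the plane. The cube is chosen so that `y^4 / (1 + y²)^3 ≤ 1 / (1 + y²)`. -/
lemma ae_isTemperedPath [SFinite P] {W : ℝ → Ω → ℝ} (hW : Measurable (Function.uncurry W)) {C : ℝ}
    (h1 : ∀ y, ∫⁻ ω, ENNReal.ofReal (W y ω ^ 8) ∂P ≤ ENNReal.ofReal (C * y ^ 4))
    (h2 : ∀ y z, ∫⁻ ω, ENNReal.ofReal ((W y ω - W z ω) ^ 8) ∂P ≤
      ENNReal.ofReal (C * (y - z) ^ 4)) (hC : 0 ≤ C) :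
    ∀ᵐ ω ∂P, IsTemperedPath (fun x => W x ω) := by
  have hscale : ∀ {X : Ω → ℝ} {c a : ℝ}, 0 ≤ c →
      ∫⁻ ω, ENNReal.ofReal (X ω) ∂P ≤ ENNReal.ofReal a →
      ∫⁻ ω, ENNReal.ofReal (X ω / c) ∂P ≤ ENNReal.ofReal (a / c) := by
    intro X c a hc h
    simp only [div_eq_inv_mul, ENNReal.ofReal_mul (inv_nonneg.2 hc)]
    rw [lintegral_const_mul' _ _ ENNReal.ofReal_ne_top]
    gcongr
  have hi1 : ∀ᵐ ω ∂P, Integrable (fun y => W y ω ^ 8 / (1 + y ^ 2) ^ 3) := by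
    refine ae_integrable_of_lintegral_le (w := fun y => C * (1 + y ^ 2)⁻¹) ?_
      (fun ω y => by positivity) (integrable_inv_one_add_sq.const_mul C) fun y => ?_
    · have hWs : Measurable (fun p : Ω × ℝ => W p.2 p.1) := hW.comp measurable_swap
      simp only [Function.uncurry_def]
      fun_prop
    · refine (hscale (by positivity) (h1 y)).trans (ENNReal.ofReal_le_ofReal ?_)
      rw [mul_div_assoc]
      gcongr
      rw [div_le_iff₀ (by positivity)]
      field_simp
      nlinarith [sq_nonneg y, sq_nonneg (y ^ 2)]
  have hi2 : ∀ᵐ ω ∂P, Integrable (weightedIncrement fun x => W x ω) := by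
    refine ae_integrable_of_lintegral_le (f := fun ω => weightedIncrement fun x => W x ω)
      (w := fun p : ℝ × ℝ => C * ((1 + p.1 ^ 2)⁻¹ * (1 + p.2 ^ 2)⁻¹)) ?_
      (fun ω p => by unfold weightedIncrement; positivity)
      ((integrable_inv_one_add_sq.mul_prod integrable_inv_one_add_sq).const_mul C) fun p => ?_
    · have hWs1 : Measurable (fun p : Ω × ℝ × ℝ => W p.2.1 p.1) :=
        hW.comp (f := fun p : Ω × ℝ × ℝ => (p.2.1, p.1)) (by fun_prop)
      have hWs2 : Measurable (fun p : Ω × ℝ × ℝ => W p.2.2 p.1) :=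
        hW.comp (f := fun p : Ω × ℝ × ℝ => (p.2.2, p.1)) (by fun_prop)
      simp only [Function.uncurry_def, weightedIncrement]
      fun_prop
    · refine (hscale (by positivity) (h2 p.1 p.2)).trans (ENNReal.ofReal_le_ofReal ?_)
      rw [mul_div_assoc, ← mul_inv]
      gcongr
      rw [div_mul_eq_div_div, ← one_div]
      gcongr
      -- An inequality rather than an equality, because the quotient is `0` on the diagonal.
      exact div_self_le_one _
  filter_upwards [hi1, hi2] with ω hω1 hω2
  have hm : Measurable (fun x => W x ω) := hW.comp measurable_prodMk_right
  refine ⟨hm, ?_, hω2⟩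
  refine (integrable_one_div_one_add_sq_pow.add hω1).mono'
    (hm.div (by fun_prop)).aestronglyMeasurable (ae_of_all _ fun y => ?_)
  have h := abs_le_add_pow_div one_pos (W y ω)
  rw [one_pow, div_one] at h
  simp only [Pi.add_apply, Real.norm_eq_abs]
  rw [← add_div, abs_div, abs_of_pos (by positivity : 0 < (1 + y ^ 2) ^ 3)]
  gcongr

end Probability

lemma sub_pow_eight_le (a b : ℝ) : (a - b) ^ 8 ≤ 128 * (a ^ 8 + b ^ 8) := by
  have h1 : (a - b) ^ 2 ≤ 2 * (a ^ 2 + b ^ 2) := by nlinarith [sq_nonneg (a + b)]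
  have h2 : (a ^ 2 + b ^ 2) ^ 2 ≤ 2 * (a ^ 4 + b ^ 4) := by nlinarith [sq_nonneg (a ^ 2 - b ^ 2)]
  have h3 : (a ^ 4 + b ^ 4) ^ 2 ≤ 2 * (a ^ 8 + b ^ 8) := by nlinarith [sq_nonneg (a ^ 4 - b ^ 4)]
  calc (a - b) ^ 8 = ((a - b) ^ 2) ^ 4 := by ring
    _ ≤ (2 * (a ^ 2 + b ^ 2)) ^ 4 := by gcongr
    _ = 16 * ((a ^ 2 + b ^ 2) ^ 2) ^ 2 := by ring
    _ ≤ 16 * (2 * (a ^ 4 + b ^ 4)) ^ 2 := by gcongr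
    _ = 64 * (a ^ 4 + b ^ 4) ^ 2 := by ring
    _ ≤ 64 * (2 * (a ^ 8 + b ^ 8)) := by gcongr
    _ = _ := by ring

namespace IsTwoSidedBrownian

variable {Ω : Type*} [MeasurableSpace Ω] {P : Measure Ω} {B : ℝ → Ω → ℝ}

lemma ae_continuous (hB : IsTwoSidedBrownian B P) : ∀ᵐ ω ∂P, Continuous (fun x => B x ω) := by
  filter_upwards [hB.right.cont, hB.left.cont] with ω h1 h2
  rw [← continuousOn_univ, ← Iic_union_Ici (a := (0 : ℝ))]
  refine ContinuousOn.union_of_isClosed ?_ ?_ isClosed_Iic isClosed_Ici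
  · refine (h2.comp (continuous_real_toNNReal.comp continuous_neg)).continuousOn.congr
      fun x hx => ?_
    simp [Real.coe_toNNReal _ (neg_nonneg.2 (mem_Iic.1 hx))]
  · refine (h1.comp continuous_real_toNNReal).continuousOn.congr fun x hx => ?_
    simp [Real.coe_toNNReal _ (mem_Ici.1 hx)]

/-- On one side of `0` the increment is Gaussian of variance `|y - z|`. Across `0`, each value is
compared with zero, and `s^4 + r^4 ≤ (s + r)^4` restores the distance at the cost of the factor 128.
-/
lemma exists_lintegral_pow_eight_le (hB : IsTwoSidedBrownian B P) : ∃ C : ℝ, 0 < C ∧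
    (∀ y, ∫⁻ ω, ENNReal.ofReal (B y ω ^ 8) ∂P ≤ ENNReal.ofReal (C * y ^ 4)) ∧
    ∀ y z, ∫⁻ ω, ENNReal.ofReal ((B y ω - B z ω) ^ 8) ∂P ≤ ENNReal.ofReal (C * (y - z) ^ 4) := by
  obtain ⟨C, hC0, hC⟩ := exists_lintegral_gaussianReal_pow_eight_le
  have hlaw : ∀ {X : Ω → ℝ} {v : ℝ≥0}, HasLaw X (gaussianReal 0 v) P →
      ∫⁻ ω, ENNReal.ofReal (X ω ^ 8) ∂P ≤ ENNReal.ofReal (C * (v : ℝ) ^ 4) := by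
    intro X v h
    have h1 := hC v
    rwa [← h.map_eq, lintegral_map' (by fun_prop) h.aemeasurable] at h1
  have hev : ∀ y, ∫⁻ ω, ENNReal.ofReal (B y ω ^ 8) ∂P ≤ ENNReal.ofReal (C * y ^ 4) := by
    intro y
    rcases le_total 0 y with hy | hy
    · lift y to ℝ≥0 using hy
      exact hlaw (hB.right.hasLaw_eval y)
    · obtain ⟨s, rfl⟩ : ∃ s : ℝ≥0, y = -s := ⟨(-y).toNNReal, by simp [hy]⟩
      rw [Even.neg_pow (by decide)]
      exact hlaw (hB.left.hasLaw_eval s)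
  have hsum : ∀ s r : ℝ≥0, ∫⁻ ω, ENNReal.ofReal ((B s ω - B (-r) ω) ^ 8) ∂P ≤
      ENNReal.ofReal (128 * C * ((s : ℝ) - -r) ^ 4) := by
    intro s r
    calc _ ≤ ∫⁻ ω, (ENNReal.ofReal 128 * ENNReal.ofReal (B s ω ^ 8) +
          ENNReal.ofReal 128 * ENNReal.ofReal (B (-r) ω ^ 8)) ∂P := by
          refine lintegral_mono fun ω => ?_
          rw [← ENNReal.ofReal_mul (by norm_num), ← ENNReal.ofReal_mul (by norm_num),
            ← ENNReal.ofReal_add (by positivity) (by positivity)]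
          refine ENNReal.ofReal_le_ofReal ?_
          rw [← mul_add]
          exact sub_pow_eight_le _ _
      _ = ENNReal.ofReal 128 * ∫⁻ ω, ENNReal.ofReal (B s ω ^ 8) ∂P +
          ENNReal.ofReal 128 * ∫⁻ ω, ENNReal.ofReal (B (-r) ω ^ 8) ∂P := by
          have hm := hB.measurable
          rw [lintegral_add_left (by fun_prop), lintegral_const_mul' _ _ ENNReal.ofReal_ne_top,
            lintegral_const_mul' _ _ ENNReal.ofReal_ne_top]
      _ ≤ ENNReal.ofReal 128 * ENNReal.ofReal (C * (s : ℝ) ^ 4) +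
          ENNReal.ofReal 128 * ENNReal.ofReal (C * (-(r : ℝ)) ^ 4) := by
          gcongr
          · exact hev s
          · exact hev (-r)
      _ ≤ _ := by
          rw [← ENNReal.ofReal_mul (by norm_num), ← ENNReal.ofReal_mul (by norm_num),
            ← ENNReal.ofReal_add (by positivity) (by positivity)]
          refine ENNReal.ofReal_le_ofReal ?_
          have h4 : (s : ℝ) ^ 4 + (r : ℝ) ^ 4 ≤ (s + r) ^ 4 := by
            have : 0 ≤ (s : ℝ) * r * (4 * s ^ 2 + 6 * s * r + 4 * r ^ 2) := by positivity
            nlinarith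
          rw [sub_neg_eq_add, Even.neg_pow (by decide)]
          nlinarith [mul_le_mul_of_nonneg_left h4 hC0.le]
  have hmono : ∀ a : ℝ, ENNReal.ofReal (C * a ^ 4) ≤ ENNReal.ofReal (128 * C * a ^ 4) := by
    intro a
    refine ENNReal.ofReal_le_ofReal ?_
    gcongr
    linarith
  have hswap : ∀ y z, ∫⁻ ω, ENNReal.ofReal ((B y ω - B z ω) ^ 8) ∂P ≤
      ENNReal.ofReal (128 * C * (y - z) ^ 4) → ∫⁻ ω, ENNReal.ofReal ((B z ω - B y ω) ^ 8) ∂P ≤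
      ENNReal.ofReal (128 * C * (z - y) ^ 4) := by
    intro y z h
    have e : ∀ ω, (B z ω - B y ω) ^ 8 = (B y ω - B z ω) ^ 8 := fun ω => by ring
    rw [show (z - y) ^ 4 = (y - z) ^ 4 by ring]
    simpa only [e] using h
  refine ⟨128 * C, by positivity, fun y => (hev y).trans (hmono y), fun y z => ?_⟩
  have hneg : ∀ y : ℝ, y ≤ 0 → ∃ s : ℝ≥0, y = -s :=
    fun y hy => ⟨(-y).toNNReal, by simp [hy]⟩
  have hdist : ∀ s r : ℝ≥0, ((nndist s.1 r.1 : ℝ≥0) : ℝ) ^ 4 = ((s : ℝ) - r) ^ 4 := by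
    intro s r
    rw [coe_nndist, Real.dist_eq, Even.pow_abs (by decide)]
    rfl
  rcases le_total 0 y with hy | hy <;> rcases le_total 0 z with hz | hz
  · lift y to ℝ≥0 using hy
    lift z to ℝ≥0 using hz
    have := hlaw (hB.right.hasLaw_sub y z)
    rw [hdist] at this
    exact this.trans (hmono _)
  · lift y to ℝ≥0 using hy
    obtain ⟨r, rfl⟩ := hneg z hz
    exact hsum y r
  · lift z to ℝ≥0 using hz
    obtain ⟨r, rfl⟩ := hneg y hy
    exact hswap _ _ (hsum z r)
  · obtain ⟨s, rfl⟩ := hneg y hy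
    obtain ⟨r, rfl⟩ := hneg z hz
    have := hlaw (hB.left.hasLaw_sub s r)
    rw [hdist] at this
    rw [show (-(s : ℝ) - -r) ^ 4 = ((s : ℝ) - r) ^ 4 by ring]
    exact this.trans (hmono _)

/-- A two-sided Brownian motion has a jointly measurable modification all of whose paths are
tempered. -/
lemma exists_tempered_modification [SFinite P] (hB : IsTwoSidedBrownian B P) :
    ∃ W : ℝ → Ω → ℝ, Measurable (Function.uncurry W) ∧
      (∀ ω, IsTemperedPath (fun x => W x ω)) ∧ ∀ᵐ ω ∂P, ∀ x, W x ω = B x ω := by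
  -- Paths are set to zero on two null sets: here the discontinuous ones, which gives joint
  -- measurability, and below the non-tempered ones. The measurability of the flow requires good
  -- behaviour for every `ω`.
  obtain ⟨A, hAc, hAm, hA⟩ := exists_measurable_superset_of_null (ae_iff.1 hB.ae_continuous)
  have hcont : ∀ ω ∉ A, Continuous fun x => B x ω := fun ω hω => by_contra fun h => hω (hAc h)
  set W : ℝ → Ω → ℝ := fun x => Aᶜ.indicator (B x) with hW
  have hWm : Measurable (Function.uncurry W) := by
    refine measurable_uncurry_of_continuous_of_measurable (fun ω => ?_)
      fun x => (hB.measurable x).indicator hAm.compl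
    by_cases hω : ω ∈ A
    · simp [hW, hω, continuous_const]
    · simpa [hW, hω] using hcont ω hω
  have hWB : ∀ᵐ ω ∂P, ∀ x, W x ω = B x ω := by
    filter_upwards [compl_mem_ae_iff.2 hA] with ω hω x
    exact indicator_of_mem hω _
  obtain ⟨C, hC0, h1, h2⟩ := hB.exists_lintegral_pow_eight_le
  have hT : ∀ᵐ ω ∂P, IsTemperedPath (fun x => W x ω) := by
    refine ae_isTemperedPath hWm (fun y => ?_) (fun y z => ?_) hC0.le
    · refine (lintegral_congr_ae ?_).trans_le (h1 y)
      filter_upwards [hWB] with ω hω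
      rw [hω]
    · refine (lintegral_congr_ae ?_).trans_le (h2 y z)
      filter_upwards [hWB] with ω hω
      rw [hω, hω]
  obtain ⟨N, hNc, hNm, hN⟩ := exists_measurable_superset_of_null (ae_iff.1 hT)
  refine ⟨fun x => Nᶜ.indicator (W x), ?_, fun ω => ?_, ?_⟩
  · have e : Function.uncurry (fun x => Nᶜ.indicator (W x)) =
        (Prod.snd ⁻¹' Nᶜ).indicator (Function.uncurry W) := rfl
    rw [e]
    exact hWm.indicator (hNm.compl.preimage measurable_snd)
  · by_cases hω : ω ∈ N
    · simpa [hω] using isTemperedPath_zero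
    · have : IsTemperedPath (fun x => W x ω) := by_contra fun h => hω (hNc h)
      simpa [hω] using this
  · filter_upwards [hWB, compl_mem_ae_iff.2 hN] with ω h1 h2 x
    rw [indicator_of_mem h2, h1]

end IsTwoSidedBrownian

theorem proposition2p1 {Ω : Type*} [MeasurableSpace Ω] (P : Measure Ω) [IsProbabilityMeasure P]
    (B : ℝ → Ω → ℝ) (hB : IsTwoSidedBrownian B P) :
    ∃ X : ℝ → Ω → ℝ,
      (∀ t, 0 ≤ t → Measurable (X t)) ∧
      ∀ᵐ ω ∂P,
        X 0 ω = 0 ∧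
        (∀ t, 0 < t →
          HasDerivAt (fun s => X s ω) (velocity (fun x => B x ω) t (X t ω)) t) ∧
        ContinuousOn (fun t => X t ω) (Ici 0) ∧
        ContDiffOn ℝ ((⊤ : ℕ∞) : WithTop ℕ∞) (fun t => X t ω) (Ioi 0) := by
  obtain ⟨W, hWm, hWT, hWB⟩ := hB.exists_tempered_modification
  choose G g hG using fun ω => (hWT ω).exists_isLinearGrowthField
  refine ⟨fun t ω => upperTrajectory (forwardVelocity fun x => W x ω) t,
    fun t _ => measurable_upperTrajectory (measurable_forwardVelocity hWm hWT) hG t, ?_⟩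
  filter_upwards [hWB] with ω hω
  refine ⟨(hG ω).upperTrajectory_zero, fun t ht => ?_, (hG ω).continuousOn_upperTrajectory,
    (hG ω).contDiffOn_upperTrajectory (hWT ω).contDiffOn_forwardVelocity⟩
  have h := (hG ω).hasDerivAt_upperTrajectory ht
  rw [forwardVelocity_of_pos _ ht] at h
  have e : (fun x => W x ω) = fun x => B x ω := funext hω
  rwa [e] at h ⊢
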